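/- Let $\Omega\subset\mathbb R^2$ be a bounded Lipschitz domain and $D$ a Lipschitz domain with $\overline D\subset\Omega$ (for instance, the interior of a convex polygon). Let $k>0$, $k\neq1$, and $\gamma=1+(k-1)\chi_D$. All functions are complex-valued, and $a\cdot b=a_1b_1+a_2b_2$ without conjugation. Identify $H^{1/2}(\partial\Omega)$ with $H^1(\Omega)/H^1_0(\Omega)$ (two functions in $H^1(\Omega)$ have the same boundary values on $\partial\Omega$ if they differ by an element of $H^1_0(\Omega)$), and write $w|_{\partial\Omega}$ for the class of $w\in H^1(\Omega)$. If $\sigma$ is a bounded measurable real coefficient and $w\in H^1(\Omega)$ is a weak solution of $\nabla\cdot\sigma\nabla w=0$ in $\Omega$, its Neumann datum on $\partial\Omega$ is the element of the dual space of $H^{1/2}(\partial\Omega)$ whose value at $f$ is $$\int_\Omega\sigma\,\nabla w\cdot\nabla\Psi\,dx\quad\text{for any }\Psi\in H^1(\Omega)\text{ with }\Psi|_{\partial\Omega}=f.$$ Let $u\in H^1(\Omega)$ be a weak solution of $\nabla\cdot\gamma\nabla u=0$ in $\Omega$, and let $v\in H^2(\Omega)$ be harmonic in $\Omega$. Let $\frac{\partial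 u}{\partial\nu}|_{\partial\Omega}$ be the Neumann datum of $u$ (with $\sigma=\gamma$) and $\frac{\partial v}{\partial\nu}|_{\partial\Omega}$ that of $v$, which is a weak solution for $\sigma\equiv1$. On $\partial D$, let $\nu$ be the unit normal that is outward to $\Omega\setminus\overline D$ (that is, pointing into $D$), and let $u|_{\partial D}\in L^2(\partial D)$ be the trace of $u$, that is, the limit in $L^2(\partial D)$ of $\varphi_n|_{\partial D}$ for smooth functions $\varphi_n$ on $\mathbb R^2$ with $\varphi_n\to u$ in $H^1(D)$. Then such a trace exists, and for every such trace and every constant $\lambda\in\mathbb C$ the function $(u-\lambda)\frac{\partial v}{\partial\nu}$ is integrable on $\partial D$ with respect to arc length and $$\Big\langle\frac{\partial u}{\partial\nu}\Big|_{\partial\Omega},v|_{\partial\Omega}\Big\rangle-\Big\langle\frac{\partial v}{\partial\nu}\Big|_{\partial\Omega},u|_{\partial\Omega}\Big\rangle=(1-k)\int_{\partial D}(u-\lambda)\frac{\partial v}{\partial\nu}\,ds.$$ -/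

import Mathlib

open MeasureTheory Set Filter Topology
open scoped ENNReal NNReal ContDiff

namespace Conductivity

/-- The plane `ℝ²` with its Euclidean norm and Lebesgue measure. -/
abbrev Plane : Type := EuclideanSpace ℝ (Fin 2)

/-- The classical partial derivative `∂f/∂xᵢ` at `x`. -/
noncomputable def partialDeriv (i : Fin 2) (f : Plane → ℂ) (x : Plane) : ℂ :=
  fderiv ℝ f x (EuclideanSpace.single i 1)

/-! ### Lipschitz domains -/

/-- `A` has Lipschitz boundary: near each boundary point and in suitable Cartesian coordinates
(an isometric affine change of variables `T`), `A` is the region above the graph of a Lipschitz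
function. -/
def HasLipschitzBoundary (A : Set Plane) : Prop :=
  ∀ x ∈ frontier A, ∃ (T : Plane ≃ᵃⁱ[ℝ] Plane) (φ : ℝ → ℝ) (L : ℝ≥0) (r : ℝ),
    0 < r ∧ LipschitzWith L φ ∧ ∀ y ∈ Metric.ball x r, (y ∈ A ↔ φ (T y 0) < T y 1)

/-- A bounded Lipschitz domain: a bounded, connected (in particular nonempty) open set with
Lipschitz boundary. -/
structure IsLipschitzDomain (A : Set Plane) : Prop where
  isOpen : IsOpen A
  isConnected : IsConnected A
  isBounded : Bornology.IsBounded A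
  lipschitz : HasLipschitzBoundary A

/-- `n` is the unit outward normal vector to `A` at the boundary point `x`: seen from `x`, the set
`A` agrees to first order with the half-plane `{y | ⟪y - x, n⟫ < 0}`. There is at most one such
vector (`IsOuterNormal.unique`). If `A` lies near `x` on one side of a Lipschitz graph, it exists
wherever the graph has a tangent, that is, at almost every boundary point for arc length. -/
def IsOuterNormal (A : Set Plane) (x n : Plane) : Prop :=
  ‖n‖ = 1 ∧ ∀ ε > 0, ∀ᶠ y in 𝓝 x,
    (y ∈ A → inner ℝ (y - x) n ≤ ε * ‖y - x‖) ∧ (y ∉ A → -(ε * ‖y - x‖) ≤ inner ℝ (y - x) n)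

theorem IsOuterNormal.unique {A : Set Plane} {x n m : Plane}
    (hn : IsOuterNormal A x n) (hm : IsOuterNormal A x m) : n = m := by
  by_contra hne
  set d := n - m with hd
  have hd0 : 0 < ‖d‖ := norm_pos_iff.2 (sub_ne_zero.2 hne)
  have hsq : inner ℝ d d = ‖d‖ ^ 2 := real_inner_self_eq_norm_sq d
  have h1 : inner ℝ d n = ‖d‖ ^ 2 / 2 ∧ inner ℝ d m = -(‖d‖ ^ 2 / 2) := by
    have hnn : inner ℝ n n = (1 : ℝ) := by rw [real_inner_self_eq_norm_sq, hn.1]; norm_num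
    have hmm : inner ℝ m m = (1 : ℝ) := by rw [real_inner_self_eq_norm_sq, hm.1]; norm_num
    have hc : inner ℝ m n = inner ℝ n m := real_inner_comm n m
    rw [← hsq, hd]
    simp only [inner_sub_left, inner_sub_right, hnn, hmm, hc]
    constructor <;> ring
  have he : 0 < ‖d‖ / 4 := by positivity
  have hlim : Tendsto (fun t : ℝ => x + t • d) (𝓝[>] 0) (𝓝 x) := by
    have : Tendsto (fun t : ℝ => x + t • d) (𝓝 0) (𝓝 (x + (0 : ℝ) • d)) :=
      (by fun_prop : Continuous fun t : ℝ => x + t • d).tendsto 0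
    simpa using this.mono_left nhdsWithin_le_nhds
  obtain ⟨t, ⟨hA, hB⟩, ht⟩ := ((hlim.eventually ((hn.2 _ he).and (hm.2 _ he))).and
    self_mem_nhdsWithin).exists
  have ht0 : 0 < t := ht
  have hnorm : ‖t • d‖ = t * ‖d‖ := by rw [norm_smul, Real.norm_of_nonneg ht0.le]
  have hpos : 0 < t * ‖d‖ ^ 2 := by positivity
  simp only [add_sub_cancel_left, inner_smul_left, hnorm, h1.1, h1.2] at hA hB
  simp only [conj_trivial] at hA hB
  by_cases hy : x + t • d ∈ A
  · have := hA.1 hy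
    nlinarith
  · have := hB.2 hy
    nlinarith

open Classical in
/-- The unit outward normal field of `A`, with the value `0` at the points where there is none. -/
noncomputable def outerNormal (A : Set Plane) (x : Plane) : Plane :=
  if h : ∃ n, IsOuterNormal A x n then h.choose else 0

/-! ### The spaces `H¹(Ω)`, `H₀¹(Ω)`, `H²(Ω)` and `H^{1/2}(∂Ω)` -/

/-- Test functions on `Ω`: complex-valued smooth functions with compact support inside `Ω`. -/
structure IsTestFunction (Ω : Set Plane) (φ : Plane → ℂ) : Prop where
  contDiff : ContDiff ℝ ∞ φ
  hasCompactSupport : HasCompactSupport φ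
  tsupport_subset : tsupport φ ⊆ Ω

/-- The complex space `L²(Ω)`. -/
abbrev L2 (Ω : Set Plane) : Type := Lp ℂ 2 (volume.restrict Ω)

/-- `g` is the weak partial derivative `∂f/∂xᵢ` in `Ω`. -/
def HasWeakPartialDeriv (Ω : Set Plane) (i : Fin 2) (f g : L2 Ω) : Prop :=
  ∀ φ : Plane → ℂ, IsTestFunction Ω φ →
    ∫ x in Ω, f x * partialDeriv i φ x = -∫ x in Ω, g x * φ x

theorem IsTestFunction.memLp {Ω : Set Plane} {φ : Plane → ℂ} (hφ : IsTestFunction Ω φ) :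
    MemLp φ 2 (volume.restrict Ω) :=
  hφ.contDiff.continuous.memLp_of_hasCompactSupport hφ.hasCompactSupport

theorem IsTestFunction.memLp_partialDeriv {Ω : Set Plane} {φ : Plane → ℂ}
    (hφ : IsTestFunction Ω φ) (i : Fin 2) : MemLp (partialDeriv i φ) 2 (volume.restrict Ω) := by
  refine Continuous.memLp_of_hasCompactSupport ?_ ?_
  · exact (hφ.contDiff.continuous_fderiv (by simp)).clm_apply continuous_const
  · exact hφ.hasCompactSupport.fderiv_apply ℝ (EuclideanSpace.single i 1)

theorem integrable_L2_mul {Ω : Set Plane} (f : L2 Ω) {φ : Plane → ℂ}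
    (hφ : MemLp φ 2 (volume.restrict Ω)) :
    Integrable (fun x => f x * φ x) (volume.restrict Ω) :=
  (Lp.memLp f).integrable_mul hφ

theorem HasWeakPartialDeriv.add {Ω : Set Plane} {i : Fin 2} {f₁ f₂ g₁ g₂ : L2 Ω}
    (h₁ : HasWeakPartialDeriv Ω i f₁ g₁) (h₂ : HasWeakPartialDeriv Ω i f₂ g₂) :
    HasWeakPartialDeriv Ω i (f₁ + f₂) (g₁ + g₂) := by
  intro φ hφ
  have e : ∀ (a b : L2 Ω) (ψ : Plane → ℂ), MemLp ψ 2 (volume.restrict Ω) →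
      ∫ x in Ω, (a + b : L2 Ω) x * ψ x = (∫ x in Ω, a x * ψ x) + ∫ x in Ω, b x * ψ x := by
    intro a b ψ hψ
    rw [← integral_add (integrable_L2_mul a hψ) (integrable_L2_mul b hψ)]
    refine integral_congr_ae ?_
    filter_upwards [Lp.coeFn_add a b] with x hx
    rw [hx, Pi.add_apply, add_mul]
  rw [e _ _ _ (hφ.memLp_partialDeriv i), e _ _ _ hφ.memLp, h₁ φ hφ, h₂ φ hφ]
  ring

theorem HasWeakPartialDeriv.smul {Ω : Set Plane} {i : Fin 2} {f g : L2 Ω}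
    (h : HasWeakPartialDeriv Ω i f g) (c : ℂ) : HasWeakPartialDeriv Ω i (c • f) (c • g) := by
  intro φ hφ
  have e : ∀ (a : L2 Ω) (ψ : Plane → ℂ),
      ∫ x in Ω, (c • a : L2 Ω) x * ψ x = c * ∫ x in Ω, a x * ψ x := by
    intro a ψ
    rw [← integral_const_mul]
    refine integral_congr_ae ?_
    filter_upwards [Lp.coeFn_smul c a] with x hx
    rw [hx, Pi.smul_apply, smul_eq_mul, mul_assoc]
  rw [e, e, h φ hφ, mul_neg]

theorem HasWeakPartialDeriv.zero (Ω : Set Plane) (i : Fin 2) :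
    HasWeakPartialDeriv Ω i 0 0 := by
  intro φ _
  have e : ∀ ψ : Plane → ℂ, ∫ x in Ω, (0 : L2 Ω) x * ψ x = 0 := by
    intro ψ
    refine integral_eq_zero_of_ae ?_
    filter_upwards [Lp.coeFn_zero ℂ 2 (volume.restrict Ω)] with x hx
    rw [hx]
    simp
  rw [e, e, neg_zero]

/-- `H¹(Ω)`, as the space of pairs `(f, (∂₁f, ∂₂f))` in `L²(Ω) × L²(Ω)²`. The norm inherited from
the (Hilbert) product is the Sobolev norm `(‖f‖² + ‖∂₁f‖² + ‖∂₂f‖²)^(1/2)`. -/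
def H1 (Ω : Set Plane) : Submodule ℂ (WithLp 2 (L2 Ω × PiLp 2 fun _ : Fin 2 => L2 Ω)) where
  carrier := {w | ∀ i, HasWeakPartialDeriv Ω i w.fst (w.snd i)}
  add_mem' := fun h₁ h₂ i => (h₁ i).add (h₂ i)
  zero_mem' := fun i => HasWeakPartialDeriv.zero Ω i
  smul_mem' := fun c _ h i => (h i).smul c

/-- The function underlying an element of `H¹(Ω)`. -/
noncomputable def val {Ω : Set Plane} (u : H1 Ω) : L2 Ω := u.1.fst

/-- The weak partial derivatives of an element of `H¹(Ω)`. -/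
noncomputable def grad {Ω : Set Plane} (u : H1 Ω) (i : Fin 2) : L2 Ω := u.1.snd i

/-- `v ∈ H²(Ω)`: the function `v ∈ H¹(Ω)` has first derivatives in `H¹(Ω)`. -/
def MemH2 {Ω : Set Plane} (v : H1 Ω) : Prop :=
  ∀ i, ∃ w : H1 Ω, val w = grad v i

/-- `H₀¹(Ω)`: the closure in `H¹(Ω)` of (the classes of) the test functions. -/
noncomputable def H10 (Ω : Set Plane) : Submodule ℂ (H1 Ω) :=
  (Submodule.span ℂ {w : H1 Ω | ∃ φ : Plane → ℂ, IsTestFunction Ω φ ∧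
    val w =ᵐ[volume.restrict Ω] φ ∧
    ∀ i, grad w i =ᵐ[volume.restrict Ω] partialDeriv i φ}).topologicalClosure

/-- The space `H^{1/2}(∂Ω)` of boundary values of functions in `H¹(Ω)`, two functions having the
same boundary values if they differ by an element of `H₀¹(Ω)`; it carries the quotient norm. -/
abbrev HHalf (Ω : Set Plane) : Type := H1 Ω ⧸ H10 Ω

/-- The boundary values `u|_{∂Ω}` of `u ∈ H¹(Ω)`, as an element of `H^{1/2}(∂Ω)`. -/
noncomputable def boundaryValue {Ω : Set Plane} (u : H1 Ω) : HHalf Ω := (H10 Ω).mkQ u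

/-! ### The equation `∇ · γ ∇u = 0` and the Neumann datum -/

/-- Bounded measurable real coefficients. -/
structure Coefficient where
  toFun : Plane → ℝ
  measurable : Measurable toFun
  bounded : ∃ C, ∀ x, |toFun x| ≤ C

/-- The constant coefficient `1`. -/
def Coefficient.one : Coefficient where
  toFun := fun _ => 1
  measurable := measurable_const
  bounded := ⟨1, fun _ => by simp⟩

/-- The coefficient `1 + (k - 1) χ_D`, which is `k` on `D` and `1` off `D`. -/
noncomputable def inclusion (k : ℝ) (D : Set Plane) (hD : MeasurableSet D) : Coefficient where
  toFun := fun x => 1 + (k - 1) * D.indicator 1 x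
  measurable := ((measurable_one.indicator hD).const_mul (k - 1)).const_add 1
  bounded := by
    refine ⟨1 + |k - 1|, fun x => (abs_add_le _ _).trans ?_⟩
    rw [abs_one, abs_mul]
    gcongr
    refine mul_le_of_le_one_right (abs_nonneg _) ?_
    by_cases hx : x ∈ D <;> simp [hx]

/-- `u` is a weak solution of `∇ · γ ∇u = 0` in `Ω`. -/
def IsWeakSolution {Ω : Set Plane} (γ : Coefficient) (u : H1 Ω) : Prop :=
  ∀ φ : Plane → ℂ, IsTestFunction Ω φ →
    ∫ x in Ω, (γ.toFun x : ℂ) * ∑ i, grad u i x * partialDeriv i φ x = 0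

theorem Coefficient.memLp_mul {Ω : Set Plane} (γ : Coefficient) (f : L2 Ω) :
    MemLp (fun x => (γ.toFun x : ℂ) * f x) 2 (volume.restrict Ω) := by
  obtain ⟨C, hC⟩ := γ.bounded
  refine (Lp.memLp f).of_le_mul (c := C) ?_ (Eventually.of_forall fun x => ?_)
  · exact (Complex.measurable_ofReal.comp γ.measurable).aestronglyMeasurable.mul
      (Lp.memLp f).aestronglyMeasurable
  · rw [norm_mul, Complex.norm_real, Real.norm_eq_abs]
    exact mul_le_mul_of_nonneg_right (hC x) (norm_nonneg _)

/-- The continuous linear map `Ψ ↦ ∂Ψ/∂xᵢ` from `H¹(Ω)` to `L²(Ω)`. -/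
noncomputable def gradL (Ω : Set Plane) (i : Fin 2) : H1 Ω →L[ℂ] L2 Ω :=
  (PiLp.proj 2 (fun _ : Fin 2 => L2 Ω) i).comp
    ((WithLp.sndL 2 ℂ (L2 Ω) (PiLp 2 fun _ : Fin 2 => L2 Ω)).comp (H1 Ω).subtypeL)

/-- The functional `Ψ ↦ ∫_Ω γ ∇u · ∇Ψ dx` on `H¹(Ω)` (see `energy_apply`). -/
noncomputable def energy {Ω : Set Plane} (γ : Coefficient) (u : H1 Ω) : H1 Ω →L[ℂ] ℂ :=
  ∑ i, ((ContinuousLinearMap.mul ℂ ℂ).lpPairing (volume.restrict Ω) 2 2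
    ((γ.memLp_mul (grad u i)).toLp _)).comp (gradL Ω i)

theorem energy_apply {Ω : Set Plane} (γ : Coefficient) (u Ψ : H1 Ω) :
    energy γ u Ψ = ∫ x in Ω, (γ.toFun x : ℂ) * ∑ i, grad u i x * grad Ψ i x := by
  have hg : ∀ i, gradL Ω i Ψ = grad Ψ i := fun i => rfl
  have hi : ∀ i, Integrable (fun x => (γ.toFun x : ℂ) * grad u i x * grad Ψ i x)
      (volume.restrict Ω) := fun i =>
    (γ.memLp_mul (grad u i)).integrable_mul (Lp.memLp (grad Ψ i))
  simp only [Finset.mul_sum, ← mul_assoc]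
  rw [integral_finsetSum _ fun i _ => hi i, energy, ContinuousLinearMap.sum_apply]
  refine Finset.sum_congr rfl fun i _ => ?_
  rw [ContinuousLinearMap.comp_apply, ContinuousLinearMap.lpPairing_eq_integral, hg]
  refine integral_congr_ae ?_
  filter_upwards [(γ.memLp_mul (grad u i)).coeFn_toLp] with x hx
  rw [ContinuousLinearMap.mul_apply', hx]

theorem IsWeakSolution.H10_le_ker {Ω : Set Plane} {γ : Coefficient} {u : H1 Ω}
    (hu : IsWeakSolution γ u) : H10 Ω ≤ (energy γ u).ker := by
  refine Submodule.topologicalClosure_minimal _ (Submodule.span_le.2 ?_)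
    (energy γ u).isClosed_ker
  rintro w ⟨φ, hφ, -, hw⟩
  change energy γ u w = 0
  rw [energy_apply, ← hu φ hφ]
  refine integral_congr_ae ?_
  filter_upwards [hw 0, hw 1] with x h0 h1
  simp only [Fin.sum_univ_two, h0, h1]

/-- The Neumann datum `γ ∂u/∂ν|_{∂Ω}` of a weak solution, as an element of the dual space of
`H^{1/2}(∂Ω)`: its value at `f` is `∫_Ω γ ∇u · ∇Ψ dx` for any `Ψ ∈ H¹(Ω)` with `Ψ = f` on `∂Ω`
(see `neumann_boundaryValue`). -/
noncomputable def neumann {Ω : Set Plane} (γ : Coefficient) (u : H1 Ω)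
    (hu : IsWeakSolution γ u) : HHalf Ω →L[ℂ] ℂ :=
  (H10 Ω).liftQL (energy γ u) hu.H10_le_ker

theorem neumann_boundaryValue {Ω : Set Plane} (γ : Coefficient) (u : H1 Ω)
    (hu : IsWeakSolution γ u) (Ψ : H1 Ω) :
    neumann γ u hu (boundaryValue Ψ) =
      ∫ x in Ω, (γ.toFun x : ℂ) * ∑ i, grad u i x * grad Ψ i x :=
  energy_apply γ u Ψ

/-! ### Traces as functions on the boundary of a subdomain -/

/-- Arc length on the boundary of `D`. -/
noncomputable def arcLength (D : Set Plane) : Measure Plane :=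
  (Measure.hausdorffMeasure 1).restrict (frontier D)

/-- `g ∈ L²(∂D)` is the trace on `∂D` of the function `u`, where `D ⊆ Ω` and `u ∈ H¹(Ω)`: for some
smooth functions `φₙ` on the plane, `φₙ → u` in `H¹(D)` and `φₙ → g` in `L²(∂D)`. -/
def IsTrace {Ω : Set Plane} (D : Set Plane) (u : H1 Ω) (g : Plane → ℂ) : Prop :=
  MemLp g 2 (arcLength D) ∧ ∃ φ : ℕ → Plane → ℂ, (∀ n, ContDiff ℝ ∞ (φ n)) ∧
    Tendsto (fun n => eLpNorm (fun x => φ n x - val u x) 2 (volume.restrict D)) atTop (𝓝 0) ∧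
    (∀ i, Tendsto (fun n => eLpNorm (fun x => partialDeriv i (φ n) x - grad u i x) 2
      (volume.restrict D)) atTop (𝓝 0)) ∧
    Tendsto (fun n => eLpNorm (fun x => φ n x - g x) 2 (arcLength D)) atTop (𝓝 0)

/-- The classical derivative of `v` at `x` in the direction of the unit normal which is outward to
`Ω ∖ closure D`. -/
noncomputable def normalDeriv (Ω D : Set Plane) (v : Plane → ℂ) (x : Plane) : ℂ :=
  fderiv ℝ v x (outerNormal (Ω \ closure D) x)

end Conductivity

/-!
Since `γ - 1 = (k - 1) χ_D`, the difference of the two boundary pairings is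
`(k - 1) ∫_D ∇u · ∇v` (`neumann_sub_neumann`). On `D` the gradient of `v` is the classical gradient
of the harmonic function `V`, which is smooth up to `∂D`, so the claim is Green's formula
`∫_D ∇u · ∇V = ∫_{∂D} (u - c) ∂V/∂n` with `n` the outward normal to `D`; the normal in the statement
is `-n`, which turns `k - 1` into `1 - k`. Green's formula passes to the limit along the smooth
functions that define the trace (`IsTrace.green`), so it is enough to have it for smooth functions
(`IsLipschitzDomain.green`).

The work is in the divergence theorem `IsLipschitzDomain.integral_fderiv` on a Lipschitz domain,
with the one-dimensional Hausdorff measure on the boundary. In a graph chart it combines two facts.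
The area formula `hausdorffMeasure_restrict_range_graphPoint` says that arc length on a Lipschitz
graph is the image of `√(1 + φ'²) ds`; it is proved by cutting the line into countably many sets on
which `φ` is almost linear. The shear `(s, τ) ↦ (s, φ s + τ)` preserves Lebesgue measure, and in its
coordinates the divergence theorem above a graph (`integral_epigraph_fderiv`) follows from Fubini,
because the derivative of a compactly supported Lipschitz function of one variable has integral
zero. A partition of unity globalizes the result.

For the existence of a trace, mollification gives smooth functions converging to `u` in `H¹(D)`
(`exists_smooth_approx`); only `closure D ⊆ Ω` matters there. Their boundary values are Cauchy
in `L²(∂D)` by the trace inequality `exists_trace_bound`, which is the divergence theorem for the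
fields `ρ |f|² e` with `e` transversal to `∂D` on the support of `ρ`.
-/

namespace Conductivity

/-! ### Arc length on a Lipschitz graph -/

/-- The parametrization `s ↦ (s, φ s)` of the graph of `φ`. -/
noncomputable def graphPoint (φ : ℝ → ℝ) (s : ℝ) : Plane := !₂[s, φ s]

/-- The arc length density `√(1 + φ'²)` of the graph of `φ`. -/
noncomputable def graphSpeed (φ : ℝ → ℝ) (s : ℝ) : ℝ := √(1 + deriv φ s ^ 2)

@[simp] theorem graphPoint_zero (φ : ℝ → ℝ) (s : ℝ) : graphPoint φ s 0 = s := rfl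

@[simp] theorem graphPoint_one (φ : ℝ → ℝ) (s : ℝ) : graphPoint φ s 1 = φ s := rfl

theorem graphPoint_injective (φ : ℝ → ℝ) : Function.Injective (graphPoint φ) := fun s t h => by
  simpa using congrArg (fun y : Plane => y 0) h

theorem continuous_graphPoint {φ : ℝ → ℝ} (hφ : Continuous φ) : Continuous (graphPoint φ) := by
  unfold graphPoint
  refine (PiLp.continuous_toLp 2 _).comp (continuous_pi fun i => ?_)
  fin_cases i
  · exact continuous_id
  · exact hφ

theorem measurableEmbedding_graphPoint {φ : ℝ → ℝ} (hφ : Continuous φ) :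
    MeasurableEmbedding (graphPoint φ) :=
  (continuous_graphPoint hφ).measurableEmbedding (graphPoint_injective φ)

theorem one_le_graphSpeed (φ : ℝ → ℝ) (s : ℝ) : 1 ≤ graphSpeed φ s :=
  Real.one_le_sqrt.2 (by nlinarith [sq_nonneg (deriv φ s)])

theorem measurable_graphSpeed (φ : ℝ → ℝ) : Measurable (graphSpeed φ) :=
  (((measurable_deriv φ).pow_const 2).const_add 1).sqrt

theorem norm_pair (a b : ℝ) : ‖(!₂[a, b] : Plane)‖ = √(a ^ 2 + b ^ 2) := by
  simp [EuclideanSpace.norm_eq, Fin.sum_univ_two]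

theorem norm_graphPoint_sub_sub (φ : ℝ → ℝ) (m x y : ℝ) :
    ‖graphPoint φ x - graphPoint φ y - (x - y) • (!₂[1, m] : Plane)‖
      = |φ x - φ y - m * (x - y)| := by
  have : graphPoint φ x - graphPoint φ y - (x - y) • (!₂[1, m] : Plane)
      = !₂[0, φ x - φ y - m * (x - y)] := by
    ext i
    fin_cases i <;> simp [graphPoint, mul_comm]
  rw [this, norm_pair]
  simp [Real.sqrt_sq_eq_abs]

theorem abs_dist_graphPoint_sub_le {φ : ℝ → ℝ} {m x y δ : ℝ}
    (h : |φ x - φ y - m * (x - y)| ≤ δ * |x - y|) :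
    |dist (graphPoint φ x) (graphPoint φ y) - √(1 + m ^ 2) * (|x - y|)| ≤ δ * |x - y| := by
  rw [← norm_graphPoint_sub_sub] at h
  have h2 := abs_norm_sub_norm_le (graphPoint φ x - graphPoint φ y) ((x - y) • (!₂[1, m] : Plane))
  rw [norm_smul, norm_pair, Real.norm_eq_abs, one_pow, mul_comm |x - y|] at h2
  rw [dist_eq_norm]
  exact h2.trans h

/-- On a set where `φ` is `δ`-close to a linear map of slope `m`, the graph map stretches lengths
by a factor which is `δ`-close to `√(1 + m²)`. -/
theorem hausdorffMeasure_graphPoint_image_bounds {φ : ℝ → ℝ} {m δ : ℝ} (hδ : 0 < δ) (hδ1 : δ < 1)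
    {s : Set ℝ} (h : ∀ x ∈ s, ∀ y ∈ s, |φ x - φ y - m * (x - y)| ≤ δ * |x - y|) :
    Measure.hausdorffMeasure 1 (graphPoint φ '' s) ≤ ENNReal.ofReal (√(1 + m ^ 2) + δ) * volume s ∧
    ENNReal.ofReal (√(1 + m ^ 2) - δ) * volume s ≤ Measure.hausdorffMeasure 1 (graphPoint φ '' s)
    := by
  have hw : 1 ≤ √(1 + m ^ 2) := Real.one_le_sqrt.2 (by nlinarith [sq_nonneg m])
  have hpos : 0 < √(1 + m ^ 2) - δ := by linarith
  constructor
  · have hL : LipschitzOnWith (√(1 + m ^ 2) + δ).toNNReal (graphPoint φ) s := by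
      refine LipschitzOnWith.of_dist_le_mul fun x hx y hy => ?_
      rw [Real.coe_toNNReal _ (by linarith), Real.dist_eq x y]
      have := (abs_le.1 (abs_dist_graphPoint_sub_le (h x hx y hy))).2
      linarith
    have := hL.hausdorffMeasure_image_le zero_le_one
    rwa [ENNReal.rpow_one, hausdorffMeasure_real] at this
  · have hL : LipschitzOnWith (√(1 + m ^ 2) - δ)⁻¹.toNNReal (fun y : Plane => y 0)
        (graphPoint φ '' s) := by
      refine LipschitzOnWith.of_dist_le_mul ?_
      rintro _ ⟨x, hx, rfl⟩ _ ⟨y, hy, rfl⟩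
      rw [Real.coe_toNNReal _ (inv_nonneg.2 hpos.le), graphPoint_zero, graphPoint_zero,
        Real.dist_eq x y, inv_mul_eq_div, le_div_iff₀ hpos]
      have := (abs_le.1 (abs_dist_graphPoint_sub_le (h x hx y hy))).1
      linarith
    have := hL.hausdorffMeasure_image_le zero_le_one
    rw [ENNReal.rpow_one, image_image, hausdorffMeasure_real] at this
    simp only [graphPoint_zero, image_id'] at this
    refine (mul_le_mul_right this _).trans_eq ?_
    change _ * (ENNReal.ofReal _ * _) = _
    rw [← mul_assoc, ← ENNReal.ofReal_mul hpos.le, mul_inv_cancel₀ hpos.ne',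
      ENNReal.ofReal_one, one_mul]

theorem abs_sqrt_one_add_sq_sub_le (a b : ℝ) : |√(1 + a ^ 2) - √(1 + b ^ 2)| ≤ |a - b| := by
  have h := abs_norm_sub_norm_le (!₂[1, a] : Plane) !₂[1, b]
  have e : (!₂[1, a] : Plane) - !₂[1, b] = !₂[0, a - b] := by
    ext i
    fin_cases i <;> simp
  rwa [e, norm_pair, norm_pair, norm_pair, one_pow, zero_pow two_ne_zero, zero_add,
    Real.sqrt_sq_eq_abs] at h

/-- Two-sided comparison, with constants close to `1`, of the length of a piece of the graph and
the integral of the arc length density. -/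
theorem hausdorffMeasure_graphPoint_image_approx {φ : ℝ → ℝ} (hφ : Continuous φ) {s : Set ℝ}
    (hs : MeasurableSet s) (hd : ∀ x ∈ s, DifferentiableAt ℝ φ x) {δ : ℝ} (hδ : 0 < δ)
    (hδ1 : δ < 1 / 2) :
    Measure.hausdorffMeasure 1 (graphPoint φ '' s) ≤
      ENNReal.ofReal (1 + 2 * δ) * ∫⁻ x in s, ENNReal.ofReal (graphSpeed φ x) ∧
    ∫⁻ x in s, ENNReal.ofReal (graphSpeed φ x) ≤
      ENNReal.ofReal (1 + 4 * δ) * Measure.hausdorffMeasure 1 (graphPoint φ '' s) := by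
  obtain ⟨t, A, tdisj, tmeas, tcover, hA, -⟩ :=
    exists_partition_approximatesLinearOn_of_hasFDerivWithinAt φ s (fderiv ℝ φ)
      (fun x hx => (hd x hx).hasFDerivAt.hasFDerivWithinAt) (fun _ => δ.toNNReal)
      (fun _ => by simpa using hδ)
  have hst : s = ⋃ n, s ∩ t n := by rw [← inter_iUnion, inter_eq_left.2 tcover]
  have smeas : ∀ n, MeasurableSet (s ∩ t n) := fun n => hs.inter (tmeas n)
  have sdisj : Pairwise (Function.onFun Disjoint fun n => s ∩ t n) := fun i j hij =>
    (tdisj hij).mono inter_subset_right inter_subset_right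
  have hH : Measure.hausdorffMeasure 1 (graphPoint φ '' s)
      = ∑' n, Measure.hausdorffMeasure 1 (graphPoint φ '' (s ∩ t n)) := by
    conv_lhs => rw [hst, image_iUnion]
    exact measure_iUnion (fun i j hij => disjoint_image_of_injective (graphPoint_injective φ)
      (sdisj hij)) fun n => (measurableEmbedding_graphPoint hφ).measurableSet_image.2 (smeas n)
  have hI : ∫⁻ x in s, ENNReal.ofReal (graphSpeed φ x)
      = ∑' n, ∫⁻ x in s ∩ t n, ENNReal.ofReal (graphSpeed φ x) := by
    conv_lhs => rw [hst]
    exact lintegral_iUnion smeas sdisj _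
  have key : ∀ n, Measure.hausdorffMeasure 1 (graphPoint φ '' (s ∩ t n)) ≤
      ENNReal.ofReal (1 + 2 * δ) * ∫⁻ x in s ∩ t n, ENNReal.ofReal (graphSpeed φ x) ∧
      ∫⁻ x in s ∩ t n, ENNReal.ofReal (graphSpeed φ x) ≤
      ENNReal.ofReal (1 + 4 * δ) * Measure.hausdorffMeasure 1 (graphPoint φ '' (s ∩ t n)) := by
    intro n
    set m := A n 1 with hm
    have hAm : ∀ z : ℝ, A n z = m * z := fun z => by
      have := (A n).map_smul z 1
      rw [smul_eq_mul, mul_one, smul_eq_mul] at this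
      rw [this, mul_comm]
    have hlin : ∀ x ∈ s ∩ t n, ∀ y ∈ s ∩ t n, |φ x - φ y - m * (x - y)| ≤ δ * |x - y| := by
      intro x hx y hy
      have := (hA n) x hx y hy
      rwa [hAm, Real.coe_toNNReal _ hδ.le] at this
    obtain ⟨h1, h2⟩ := hausdorffMeasure_graphPoint_image_bounds hδ (by linarith) hlin
    have hw : 1 ≤ √(1 + m ^ 2) := Real.one_le_sqrt.2 (by nlinarith [sq_nonneg m])
    have hder : ∀ᵐ x ∂volume.restrict (s ∩ t n), |graphSpeed φ x - √(1 + m ^ 2)| ≤ δ := by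
      filter_upwards [(hA n).norm_fderiv_sub_le volume (smeas n) (fderiv ℝ φ)
        (fun x hx => (hd x hx.1).hasFDerivAt.hasFDerivWithinAt)] with x hx
      have h3 : ‖(fderiv ℝ φ x - A n) 1‖ ≤ δ := by
        have h4 : ‖fderiv ℝ φ x - A n‖ ≤ δ := by
          have : ((‖fderiv ℝ φ x - A n‖₊ : ℝ≥0) : ℝ) ≤ (δ.toNNReal : ℝ≥0) := by exact_mod_cast hx
          rwa [Real.coe_toNNReal _ hδ.le] at this
        exact ((fderiv ℝ φ x - A n).le_opNorm 1).trans (by simpa using h4)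
      refine (abs_sqrt_one_add_sq_sub_le _ _).trans ?_
      simpa [fderiv_eq_smul_deriv] using h3
    have hlow : ENNReal.ofReal (√(1 + m ^ 2) - δ) * volume (s ∩ t n)
        ≤ ∫⁻ x in s ∩ t n, ENNReal.ofReal (graphSpeed φ x) := by
      rw [← setLIntegral_const]
      refine lintegral_mono_ae ?_
      filter_upwards [hder] with x hx
      exact ENNReal.ofReal_le_ofReal (by linarith [(abs_le.1 hx).1])
    have hup : ∫⁻ x in s ∩ t n, ENNReal.ofReal (graphSpeed φ x)
        ≤ ENNReal.ofReal (√(1 + m ^ 2) + δ) * volume (s ∩ t n) := by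
      rw [← setLIntegral_const]
      refine lintegral_mono_ae ?_
      filter_upwards [hder] with x hx
      exact ENNReal.ofReal_le_ofReal (by linarith [(abs_le.1 hx).2])
    have hvol : volume (s ∩ t n) ≤ ∫⁻ x in s ∩ t n, ENNReal.ofReal (graphSpeed φ x) := by
      calc volume (s ∩ t n) = ∫⁻ x in s ∩ t n, 1 := by simp
        _ ≤ _ := lintegral_mono fun x => by
          simpa using ENNReal.ofReal_le_ofReal (one_le_graphSpeed φ x)
    constructor
    · calc _ ≤ ENNReal.ofReal (√(1 + m ^ 2) + δ) * volume (s ∩ t n) := h1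
        _ = ENNReal.ofReal (√(1 + m ^ 2) - δ) * volume (s ∩ t n)
            + ENNReal.ofReal (2 * δ) * volume (s ∩ t n) := by
          rw [← add_mul, ← ENNReal.ofReal_add (by linarith) (by linarith)]
          congr 2
          ring
        _ ≤ _ := by
          rw [ENNReal.ofReal_add zero_le_one (by linarith), add_mul, ENNReal.ofReal_one, one_mul]
          gcongr
    -- `√(1 + m²) + δ ≤ (1 + 4 δ) (√(1 + m²) - δ)`, as `√(1 + m²) ≥ 1` and `δ < 1 / 2`
    · refine hup.trans (le_trans ?_ (mul_le_mul_right h2 _))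
      rw [← mul_assoc, ← ENNReal.ofReal_mul (by linarith)]
      gcongr
      nlinarith
  rw [hH, hI]
  constructor
  · rw [← ENNReal.tsum_mul_left]
    exact ENNReal.tsum_le_tsum fun n => (key n).1
  · rw [← ENNReal.tsum_mul_left]
    exact ENNReal.tsum_le_tsum fun n => (key n).2

/-- The area formula for a Lipschitz graph. -/
theorem hausdorffMeasure_graphPoint_image {φ : ℝ → ℝ} {L : ℝ≥0} (hφ : LipschitzWith L φ)
    {s : Set ℝ} (hs : MeasurableSet s) :
    Measure.hausdorffMeasure 1 (graphPoint φ '' s)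
      = ∫⁻ x in s, ENNReal.ofReal (graphSpeed φ x) := by
  set N : Set ℝ := {x | DifferentiableAt ℝ φ x} with hN
  have hNm : MeasurableSet N := measurableSet_of_differentiableAt ℝ φ
  have hN0 : volume (s \ N) = 0 :=
    measure_mono_null (fun x hx => hx.2) (ae_iff.1 hφ.ae_differentiableAt)
  have hL : LipschitzWith (1 + L) (graphPoint φ) := by
    refine LipschitzWith.of_dist_le_mul fun x y => ?_
    have h0 := hφ.dist_le_mul x y
    have h1 := abs_dist_graphPoint_sub_le (φ := φ) (m := 0) (x := x) (y := y) (δ := L)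
      (by simpa [Real.dist_eq] using h0)
    have := (abs_le.1 h1).2
    norm_num at this
    rw [Real.dist_eq x y]
    push_cast
    linarith
  have h1 : Measure.hausdorffMeasure 1 (graphPoint φ '' s)
      = Measure.hausdorffMeasure 1 (graphPoint φ '' (s ∩ N)) := by
    refine le_antisymm ?_ (measure_mono (image_mono inter_subset_left))
    conv_lhs => rw [← inter_union_sdiff s N, image_union]
    refine (measure_union_le _ _).trans ?_
    have : Measure.hausdorffMeasure 1 (graphPoint φ '' (s \ N)) = 0 := by
      have := hL.hausdorffMeasure_image_le zero_le_one (s \ N)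
      rwa [hausdorffMeasure_real, hN0, mul_zero, nonpos_iff_eq_zero] at this
    rw [this, add_zero]
  have h2 : ∫⁻ x in s, ENNReal.ofReal (graphSpeed φ x)
      = ∫⁻ x in s ∩ N, ENNReal.ofReal (graphSpeed φ x) := by
    refine setLIntegral_congr ?_
    refine (ae_eq_set.2 ⟨?_, ?_⟩)
    · rwa [sdiff_self_inter]
    · simp [sdiff_eq_empty.2 inter_subset_left]
  rw [h1, h2]
  have happ := fun δ (h : 0 < δ ∧ δ < (1 / 2 : ℝ)) =>
    hausdorffMeasure_graphPoint_image_approx hφ.continuous (hs.inter hNm) (fun x hx => hx.2) h.1 h.2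
  have hev : ∀ᶠ δ in 𝓝[>] (0 : ℝ), 0 < δ ∧ δ < 1 / 2 :=
    Ioo_mem_nhdsGT (by norm_num)
  have hlim : ∀ (c : ℝ) (B : ℝ≥0∞),
      Tendsto (fun δ : ℝ => ENNReal.ofReal (1 + c * δ) * B) (𝓝[>] 0) (𝓝 B) := by
    intro c B
    have h3 : Tendsto (fun δ : ℝ => ENNReal.ofReal (1 + c * δ)) (𝓝[>] 0) (𝓝 1) := by
      have : Tendsto (fun δ : ℝ => ENNReal.ofReal (1 + c * δ)) (𝓝 0)
          (𝓝 (ENNReal.ofReal (1 + c * 0))) :=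
        (ENNReal.continuous_ofReal.comp (by fun_prop)).tendsto 0
      simpa using this.mono_left nhdsWithin_le_nhds
    simpa using ENNReal.Tendsto.mul_const h3 (Or.inl one_ne_zero)
  refine le_antisymm ?_ ?_
  · exact ge_of_tendsto (hlim 2 _) (hev.mono fun δ h => (happ δ h).1)
  · exact ge_of_tendsto (hlim 4 _) (hev.mono fun δ h => (happ δ h).2)

/-- Arc length on a Lipschitz graph is the image of `√(1 + φ'²) ds` under the parametrization. -/
theorem hausdorffMeasure_restrict_range_graphPoint {φ : ℝ → ℝ} {L : ℝ≥0}
    (hφ : LipschitzWith L φ) :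
    (Measure.hausdorffMeasure 1).restrict (range (graphPoint φ))
      = (volume.withDensity fun s => ENNReal.ofReal (graphSpeed φ s)).map (graphPoint φ) := by
  have he := measurableEmbedding_graphPoint hφ.continuous
  ext s hs
  rw [Measure.restrict_apply hs, he.map_apply,
    withDensity_apply _ (he.measurable hs), ← hausdorffMeasure_graphPoint_image hφ
    (he.measurable hs), image_preimage_eq_inter_range]

/-! ### The divergence theorem above a Lipschitz graph -/

theorem integral_deriv_eq_zero_of_lipschitzWith_real {f : ℝ → ℝ} {C : ℝ≥0}
    (hf : LipschitzWith C f) (hc : HasCompactSupport f) : ∫ x, deriv f x = 0 := by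
  have h := LipschitzWith.integral_lineDeriv_mul_eq (μ := (volume : Measure ℝ))
    (LipschitzWith.const (1 : ℝ)) hf hc (-1)
  simp only [neg_neg, mul_one] at h
  have h0 : ∀ x : ℝ, lineDeriv ℝ (fun _ : ℝ => (1 : ℝ)) x (-1) = 0 := fun x => by
    simp [lineDeriv]
  simp only [h0, zero_mul, integral_zero] at h
  rw [h]
  refine integral_congr_ae ?_
  filter_upwards [hf.ae_differentiableAt] with x hx
  rw [hx.lineDeriv_eq_fderiv, fderiv_eq_smul_deriv, one_smul]

/-- The derivative of a compactly supported Lipschitz function has integral zero. -/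
theorem integral_deriv_eq_zero_of_lipschitzWith {f : ℝ → ℂ} {C : ℝ≥0}
    (hf : LipschitzWith C f) (hc : HasCompactSupport f) : ∫ x, deriv f x = 0 := by
  have hint : Integrable (deriv f) := by
    have h1 : IntegrableOn (deriv f) (tsupport f) :=
      Measure.integrableOn_of_bounded (M := C) hc.isCompact.measure_lt_top.ne
        (measurable_deriv f).aestronglyMeasurable
        (Eventually.of_forall fun _ => norm_deriv_le_of_lipschitz hf)
    refine (integrableOn_iff_integrable_of_support_subset ?_).1 h1
    exact support_deriv_subset
  have hre : ∫ x, (deriv f x).re = 0 := by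
    rw [← integral_deriv_eq_zero_of_lipschitzWith_real (f := fun x => (f x).re)
      (C := ‖Complex.reCLM‖₊ * C) (Complex.reCLM.lipschitz.comp hf)
      (hc.comp_left (g := Complex.re) rfl)]
    refine integral_congr_ae ?_
    filter_upwards [hf.ae_differentiableAt] with x hx
    exact ((Complex.reCLM.hasFDerivAt.comp_hasDerivAt x hx.hasDerivAt).deriv).symm
  have him : ∫ x, (deriv f x).im = 0 := by
    rw [← integral_deriv_eq_zero_of_lipschitzWith_real (f := fun x => (f x).im)
      (C := ‖Complex.imCLM‖₊ * C) (Complex.imCLM.lipschitz.comp hf)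
      (hc.comp_left (g := Complex.im) rfl)]
    refine integral_congr_ae ?_
    filter_upwards [hf.ae_differentiableAt] with x hx
    exact ((Complex.imCLM.hasFDerivAt.comp_hasDerivAt x hx.hasDerivAt).deriv).symm
  have h1 := integral_re hint
  have h2 := integral_im hint
  refine Complex.ext ?_ ?_
  · exact h1.symm.trans hre
  · exact h2.symm.trans him

/-- The region strictly above the graph of `φ`. -/
def epigraph (φ : ℝ → ℝ) : Set Plane := {y | φ (y 0) < y 1}

/-- The shear `(s, τ) ↦ (s, φ s + τ)`, which straightens the graph of `φ`. -/
noncomputable def shear (φ : ℝ → ℝ) (hφ : Continuous φ) : (ℝ × ℝ) ≃ₜ Plane where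
  toFun p := !₂[p.1, φ p.1 + p.2]
  invFun y := (y 0, y 1 - φ (y 0))
  left_inv p := by simp
  right_inv y := by
    ext i
    fin_cases i <;> simp
  continuous_toFun := by
    refine (PiLp.continuous_toLp 2 _).comp (continuous_pi fun i => ?_)
    fin_cases i
    · exact continuous_fst
    · exact (hφ.comp continuous_fst).add continuous_snd
  continuous_invFun := by fun_prop

theorem shear_apply (φ : ℝ → ℝ) (hφ : Continuous φ) (p : ℝ × ℝ) :
    shear φ hφ p = !₂[p.1, φ p.1 + p.2] := rfl

theorem shear_preimage_epigraph (φ : ℝ → ℝ) (hφ : Continuous φ) :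
    shear φ hφ ⁻¹' epigraph φ = univ ×ˢ Ioi 0 := by
  ext p
  simp [shear_apply, epigraph]

theorem measurePreserving_shear (φ : ℝ → ℝ) (hφ : Continuous φ) :
    MeasurePreserving (shear φ hφ) (volume.prod volume) volume := by
  have h1 : MeasurePreserving (fun p : ℝ × ℝ => (p.1, φ p.1 + p.2)) (volume.prod volume)
      (volume.prod volume) :=
    (MeasurePreserving.id volume).skew_product (g := fun a c => φ a + c)
      (by fun_prop)
      (Eventually.of_forall fun a => (measurePreserving_add_left volume (φ a)).map_eq)
  exact (PiLp.volume_preserving_toLp (Fin 2)).comp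
    ((volume_preserving_finTwoArrow ℝ).symm.comp h1)

theorem isOpen_epigraph {φ : ℝ → ℝ} (hφ : Continuous φ) : IsOpen (epigraph φ) :=
  isOpen_lt (by fun_prop) (by fun_prop)

/-- Divergence theorem above the graph of a Lipschitz function, for the field `h e`. The vector
`(φ', -1)` is the outward normal, not normalized. -/
theorem integral_epigraph_fderiv {φ : ℝ → ℝ} {L : ℝ≥0} (hφ : LipschitzWith L φ) {h : Plane → ℂ}
    (hh : ContDiff ℝ 1 h) (hc : HasCompactSupport h) (e : Plane) :
    ∫ y in epigraph φ, fderiv ℝ h y e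
      = ∫ s, ((deriv φ s * e 0 - e 1 : ℝ) : ℂ) * h (graphPoint φ s) := by
  have hφc := hφ.continuous
  set Φ := shear φ hφc with hΦ
  have hmp : MeasurePreserving Φ (volume.prod (volume.restrict (Ioi 0)))
      (volume.restrict (epigraph φ)) := by
    have := (measurePreserving_shear φ hφc).restrict_preimage (isOpen_epigraph hφc).measurableSet
    rwa [shear_preimage_epigraph, ← Measure.prod_restrict, Measure.restrict_univ] at this
  rw [← hmp.integral_comp Φ.measurableEmbedding]
  -- split `e = e₀ (1, φ') + (e₁ - φ' e₀) (0, 1)`: tangential and vertical parts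
  set A : ℝ × ℝ → ℂ := fun p => fderiv ℝ h (Φ p) !₂[1, deriv φ p.1] with hA
  set B : ℝ × ℝ → ℂ := fun p =>
    ((e 1 - deriv φ p.1 * e 0 : ℝ) : ℂ) * fderiv ℝ h (Φ p) !₂[0, 1] with hB
  have hsplit : ∀ p, fderiv ℝ h (Φ p) e = (e 0 : ℂ) * A p + B p := by
    intro p
    have : e = e 0 • (!₂[1, deriv φ p.1] : Plane) + (e 1 - deriv φ p.1 * e 0) • !₂[0, 1] := by
      ext i
      fin_cases i
      · simp
      · simp
        ring
    conv_lhs => rw [this]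
    rw [map_add, map_smul, map_smul, hA, hB, Complex.real_smul, Complex.real_smul]
  have hcont : ∀ v : Plane, Integrable (fun p => fderiv ℝ h (Φ p) v) (volume.prod volume) := by
    intro v
    have h1 : Continuous fun y => fderiv ℝ h y v :=
      (hh.continuous_fderiv one_ne_zero).clm_apply continuous_const
    exact (measurePreserving_shear φ hφc).integrable_comp_of_integrable
      (h1.integrable_of_hasCompactSupport (hc.fderiv_apply ℝ v))
  have hφm : ∀ a b : ℝ, AEStronglyMeasurable
      (fun p : ℝ × ℝ => ((a + deriv φ p.1 * b : ℝ) : ℂ)) (volume.prod volume) := by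
    intro a b
    have := (measurable_deriv φ).comp (measurable_fst : Measurable (Prod.fst : ℝ × ℝ → ℝ))
    exact (Complex.measurable_ofReal.comp
      ((this.mul_const b).const_add a)).aestronglyMeasurable
  have hφb : ∀ a b x : ℝ, ‖((a + deriv φ x * b : ℝ) : ℂ)‖ ≤ |a| + L * |b| := by
    intro a b x
    rw [Complex.norm_real, Real.norm_eq_abs]
    refine (abs_add_le _ _).trans ?_
    rw [abs_mul]
    gcongr
    exact norm_deriv_le_of_lipschitz hφ
  have hAint : Integrable A (volume.prod volume) := by
    have : A = fun p => fderiv ℝ h (Φ p) !₂[1, 0]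
        + ((0 + deriv φ p.1 * 1 : ℝ) : ℂ) * fderiv ℝ h (Φ p) !₂[0, 1] := by
      funext p
      have : (!₂[1, deriv φ p.1] : Plane) = !₂[1, 0] + (0 + deriv φ p.1 * 1) • !₂[0, 1] := by
        ext i
        fin_cases i <;> simp
      rw [hA]
      simp only
      rw [this, map_add, map_smul, Complex.real_smul]
    rw [this]
    exact (hcont _).add ((hcont _).bdd_mul (hφm 0 1) (Eventually.of_forall fun p => hφb 0 1 p.1))
  have hBint : Integrable B (volume.prod volume) := by
    have : B = fun p => ((e 1 + deriv φ p.1 * (-e 0) : ℝ) : ℂ) * fderiv ℝ h (Φ p) !₂[0, 1] := by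
      funext p
      rw [hB]
      simp only
      congr 2
      ring
    rw [this]
    exact (hcont _).bdd_mul (hφm _ _) (Eventually.of_forall fun p => hφb _ _ p.1)
  have hres : (volume.prod (volume.restrict (Ioi (0 : ℝ))) : Measure (ℝ × ℝ)) ≤
      volume.prod volume := by
    have := Measure.prod_restrict (μ := (volume : Measure ℝ)) (ν := (volume : Measure ℝ)) univ
      (Ioi (0 : ℝ))
    rw [Measure.restrict_univ] at this
    rw [this]
    exact Measure.restrict_le_self
  have hAint' := hAint.mono_measure hres
  have hBint' := hBint.mono_measure hres
  simp only [hsplit]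
  rw [integral_add (hAint'.const_mul _) hBint', integral_const_mul, integral_prod_symm _ hAint',
    integral_prod _ hBint']
  have hA0 : ∀ τ : ℝ, ∫ s, A (s, τ) = 0 := by
    intro τ
    obtain ⟨K, hK⟩ := hh.lipschitzWith_of_hasCompactSupport hc one_ne_zero
    set k : ℝ → ℂ := fun s => h (Φ (s, τ)) with hk
    have hΦL : LipschitzWith (1 + L) fun s => Φ (s, τ) := by
      refine LipschitzWith.of_dist_le_mul fun x y => ?_
      have h0 := hφ.dist_le_mul x y
      have h1 := abs_dist_graphPoint_sub_le (φ := fun s => φ s + τ) (m := 0) (x := x) (y := y)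
        (δ := L) (by simpa [Real.dist_eq] using h0)
      have := (abs_le.1 h1).2
      norm_num at this
      rw [Real.dist_eq x y]
      push_cast
      have e : dist (Φ (x, τ)) (Φ (y, τ))
        = dist (graphPoint (fun s => φ s + τ) x) (graphPoint (fun s => φ s + τ) y) := rfl
      linarith
    have hkc : HasCompactSupport k := by
      have h1 : HasCompactSupport (h ∘ Φ) := hc.comp_homeomorph Φ
      refine HasCompactSupport.of_support_subset_isCompact (h1.isCompact.image continuous_fst) ?_
      intro s hs
      exact ⟨(s, τ), subset_tsupport _ hs, rfl⟩
    rw [← integral_deriv_eq_zero_of_lipschitzWith (hK.comp hΦL) hkc]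
    refine integral_congr_ae ?_
    filter_upwards [hφ.ae_differentiableAt] with s hs
    have hd : HasDerivAt (fun s => Φ (s, τ)) (!₂[1, deriv φ s] : Plane) s := by
      have h1 : HasDerivAt (fun s => ![s, φ s + τ]) ![1, deriv φ s] s := by
        refine hasDerivAt_pi.2 fun i => ?_
        fin_cases i
        · exact hasDerivAt_id s
        · exact hs.hasDerivAt.add_const τ
      exact (PiLp.hasFDerivAt_toLp (𝕜 := ℝ) (E := fun _ : Fin 2 => ℝ) 2 _).comp_hasDerivAt s h1
    exact (((hh.differentiable one_ne_zero _).hasFDerivAt.comp_hasDerivAt s hd).deriv).symm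
  simp only [hA0, integral_zero, mul_zero, zero_add]
  refine integral_congr_ae (Eventually.of_forall fun s => ?_)
  simp only [hB]
  rw [integral_const_mul]
  have hv : ∫ τ in Ioi 0, fderiv ℝ h (Φ (s, τ)) !₂[0, 1] = - h (graphPoint φ s) := by
    set k : ℝ → ℂ := fun τ => h (graphPoint φ s + τ • !₂[0, 1]) with hk
    have hΦk : ∀ τ, Φ (s, τ) = graphPoint φ s + τ • !₂[0, 1] := by
      intro τ
      ext i
      fin_cases i <;> simp [hΦ, shear_apply, graphPoint]
    have hlin : ContDiff ℝ 1 fun τ : ℝ => graphPoint φ s + τ • (!₂[0, 1] : Plane) := by fun_prop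
    have hkd : ContDiff ℝ 1 k := hh.comp hlin
    have hkc : HasCompactSupport k := by
      have h1 : HasCompactSupport (h ∘ Φ) := hc.comp_homeomorph Φ
      refine HasCompactSupport.of_support_subset_isCompact (h1.isCompact.image continuous_snd) ?_
      intro τ hτ
      refine ⟨(s, τ), subset_tsupport _ ?_, rfl⟩
      simpa [hk, hΦk] using hτ
    have := hkc.integral_Ioi_deriv_eq hkd 0
    simp only [hk, zero_smul, add_zero] at this
    rw [← this]
    refine integral_congr_ae (Eventually.of_forall fun τ => ?_)
    simp only [hΦk]
    have hd : HasDerivAt (fun τ : ℝ => graphPoint φ s + τ • (!₂[0, 1] : Plane)) !₂[0, 1] τ := by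
      simpa using ((hasDerivAt_id τ).smul_const (!₂[0, 1] : Plane)).const_add (graphPoint φ s)
    exact (((hh.differentiable one_ne_zero _).hasFDerivAt.comp_hasDerivAt τ hd).deriv).symm
  rw [hv]
  push_cast
  ring

/-! ### Local structure of the boundary of a Lipschitz domain -/

theorem IsOuterNormal.outerNormal_eq {A : Set Plane} {x n : Plane} (h : IsOuterNormal A x n) :
    outerNormal A x = n := by
  have hex : ∃ n, IsOuterNormal A x n := ⟨n, h⟩
  rw [outerNormal, dif_pos hex]
  exact hex.choose_spec.unique h

theorem norm_outerNormal_le (A : Set Plane) (x : Plane) : ‖outerNormal A x‖ ≤ 1 := by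
  unfold outerNormal
  split_ifs with h
  · exact h.choose_spec.1.le
  · simp

/-- Inside the open set `Ω`, the outward normal to `A` is the inward normal to `Ω ∖ closure A`. -/
theorem IsOuterNormal.sdiff_closure {Ω A : Set Plane} (hΩ : IsOpen Ω) {x n : Plane} (hx : x ∈ Ω)
    (h : IsOuterNormal A x n) : IsOuterNormal (Ω \ closure A) x (-n) := by
  refine ⟨by rw [norm_neg, h.1], fun ε hε => ?_⟩
  obtain ⟨U, hU, hUo, hxU⟩ := eventually_nhds_iff.1 (h.2 ε hε)
  filter_upwards [hUo.mem_nhds hxU, hΩ.mem_nhds hx] with y hyU hyΩ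
  rw [inner_neg_right]
  refine ⟨fun hy => ?_, fun hy => ?_⟩
  · have := (hU y hyU).2 fun hyA => hy.2 (subset_closure hyA)
    linarith
  · have hyc : y ∈ closure A := by
      by_contra hc
      exact hy ⟨hyΩ, hc⟩
    have hyc' : y ∈ closure (U ∩ A) := hUo.inter_closure ⟨hyU, hyc⟩
    have hcl : IsClosed {z : Plane | inner ℝ (z - x) n ≤ ε * ‖z - x‖} :=
      isClosed_le (by fun_prop) (by fun_prop)
    have : y ∈ {z : Plane | inner ℝ (z - x) n ≤ ε * ‖z - x‖} :=
      closure_minimal (fun z hz => (hU z hz.1).1 hz.2) hcl hyc'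
    have h2 : inner ℝ (y - x) n ≤ ε * ‖y - x‖ := this
    linarith

/-- The outward unit normal at `(s, φ s)` of the region above the graph of `φ`. -/
noncomputable def graphNormal (φ : ℝ → ℝ) (s : ℝ) : Plane :=
  (graphSpeed φ s)⁻¹ • !₂[deriv φ s, -1]

theorem graphSpeed_pos (φ : ℝ → ℝ) (s : ℝ) : 0 < graphSpeed φ s :=
  zero_lt_one.trans_le (one_le_graphSpeed φ s)

theorem norm_graphNormal (φ : ℝ → ℝ) (s : ℝ) : ‖graphNormal φ s‖ = 1 := by
  have h : ‖(!₂[deriv φ s, -1] : Plane)‖ = graphSpeed φ s := by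
    rw [norm_pair, graphSpeed]
    congr 1
    ring
  rw [graphNormal, norm_smul, h, norm_inv, Real.norm_of_nonneg (graphSpeed_pos φ s).le,
    inv_mul_cancel₀ (graphSpeed_pos φ s).ne']

theorem inner_graphNormal (φ : ℝ → ℝ) (s : ℝ) (w : Plane) :
    inner ℝ (graphNormal φ s) w = (graphSpeed φ s)⁻¹ * (deriv φ s * w 0 - w 1) := by
  rw [graphNormal, inner_smul_left, PiLp.inner_apply, Fin.sum_univ_two]
  simp
  left
  ring

theorem measurable_graphNormal (φ : ℝ → ℝ) : Measurable (graphNormal φ) := by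
  refine (measurable_graphSpeed φ).inv.smul ?_
  refine (PiLp.continuous_toLp 2 _).measurable.comp (measurable_pi_iff.2 fun i => ?_)
  fin_cases i
  · exact measurable_deriv φ
  · exact measurable_const

theorem abs_apply_le_norm (w : Plane) (i : Fin 2) : |w i| ≤ ‖w‖ :=
  PiLp.norm_apply_le w i

/-- First order contact of the graph with its tangent line, for points above and below it. -/
theorem eventually_graphNormal_bounds {φ : ℝ → ℝ} {s : ℝ} (hs : DifferentiableAt ℝ φ s) {ε : ℝ}
    (hε : 0 < ε) : ∀ᶠ w in 𝓝 (graphPoint φ s),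
      (φ (w 0) < w 1 → inner ℝ (w - graphPoint φ s) (graphNormal φ s) ≤
        ε * ‖w - graphPoint φ s‖) ∧
      (w 1 ≤ φ (w 0) → -(ε * ‖w - graphPoint φ s‖) ≤
        inner ℝ (w - graphPoint φ s) (graphNormal φ s)) := by
  have h1 : ∀ᶠ a in 𝓝 s, |φ a - φ s - (a - s) * deriv φ s| ≤ ε * |a - s| := by
    have := (hasDerivAt_iff_isLittleO.1 hs.hasDerivAt).def hε
    simpa using this
  have h2 : Tendsto (fun w : Plane => w 0) (𝓝 (graphPoint φ s)) (𝓝 s) := by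
    have : Continuous fun w : Plane => w 0 := by fun_prop
    exact this.tendsto (graphPoint φ s)
  filter_upwards [h2.eventually h1] with w hw
  have hn : |w 0 - s| ≤ ‖w - graphPoint φ s‖ := abs_apply_le_norm (w - graphPoint φ s) 0
  have hw' : |φ (w 0) - φ s - (w 0 - s) * deriv φ s| ≤ ε * ‖w - graphPoint φ s‖ :=
    hw.trans (by gcongr)
  obtain ⟨hl, hu⟩ := abs_le.1 hw'
  have hin : inner ℝ (w - graphPoint φ s) (graphNormal φ s)
      = (deriv φ s * (w 0 - s) - (w 1 - φ s)) / graphSpeed φ s := by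
    rw [real_inner_comm, inner_graphNormal, inv_mul_eq_div]
    simp
  have hE : ε * ‖w - graphPoint φ s‖ ≤ ε * ‖w - graphPoint φ s‖ * graphSpeed φ s :=
    le_mul_of_one_le_right (by positivity) (one_le_graphSpeed φ s)
  rw [hin]
  refine ⟨fun h => ?_, fun h => ?_⟩
  · rw [div_le_iff₀ (graphSpeed_pos φ s)]
    linarith
  · rw [le_div_iff₀ (graphSpeed_pos φ s)]
    linarith

theorem affineIsometryEquiv_eq (T : Plane ≃ᵃⁱ[ℝ] Plane) :
    (T : Plane → Plane) = fun y => T.linearIsometryEquiv y + T 0 := by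
  funext y
  have := T.map_vadd 0 y
  simpa using this

theorem hasFDerivAt_affineIsometryEquiv (T : Plane ≃ᵃⁱ[ℝ] Plane) (y : Plane) :
    HasFDerivAt T (T.linearIsometryEquiv.toContinuousLinearEquiv : Plane →L[ℝ] Plane) y := by
  rw [affineIsometryEquiv_eq T]
  exact (T.linearIsometryEquiv.toContinuousLinearEquiv :
    Plane →L[ℝ] Plane).hasFDerivAt.add_const _

theorem contDiff_affineIsometryEquiv (T : Plane ≃ᵃⁱ[ℝ] Plane) : ContDiff ℝ 1 T := by
  rw [affineIsometryEquiv_eq T]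
  exact T.linearIsometryEquiv.contDiff.add contDiff_const

theorem measurePreserving_affineIsometryEquiv (T : Plane ≃ᵃⁱ[ℝ] Plane) :
    MeasurePreserving T volume volume := by
  rw [affineIsometryEquiv_eq T]
  exact (measurePreserving_add_right volume (T 0)).comp T.linearIsometryEquiv.measurePreserving

theorem inner_map_graphNormal (T : Plane ≃ᵃⁱ[ℝ] Plane) (φ : ℝ → ℝ) (s : ℝ) (e : Plane) :
    inner ℝ (T.symm.linearIsometryEquiv (graphNormal φ s)) e
      = (graphSpeed φ s)⁻¹ *
        (deriv φ s * T.linearIsometryEquiv e 0 - T.linearIsometryEquiv e 1) := by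
  have : e = T.symm.linearIsometryEquiv (T.linearIsometryEquiv e) :=
    (LinearIsometryEquiv.symm_apply_apply T.linearIsometryEquiv e).symm
  conv_lhs => rw [this]
  rw [LinearIsometryEquiv.inner_map_map, inner_graphNormal]

/-- In the ball `ball x r`, and in the Cartesian coordinates `T`, the open set `D` is the region
above the graph of the `L`-Lipschitz function `φ`. -/
structure IsGraphChart (D : Set Plane) (x : Plane) (r : ℝ) (T : Plane ≃ᵃⁱ[ℝ] Plane) (φ : ℝ → ℝ)
    (L : ℝ≥0) : Prop where
  isOpen : IsOpen D
  lipschitz : LipschitzWith L φ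
  mem_iff : ∀ y ∈ Metric.ball x r, (y ∈ D ↔ φ (T y 0) < T y 1)

namespace IsGraphChart

variable {D : Set Plane} {x : Plane} {r : ℝ} {T : Plane ≃ᵃⁱ[ℝ] Plane} {φ : ℝ → ℝ} {L : ℝ≥0}

theorem mem_frontier_iff (h : IsGraphChart D x r T φ L) {y : Plane} (hy : y ∈ Metric.ball x r) :
    y ∈ frontier D ↔ φ (T y 0) = T y 1 := by
  have hφ := h.lipschitz.continuous
  have hT : Continuous T := T.continuous
  rw [h.isOpen.frontier_eq]
  constructor
  · rintro ⟨hcl, hn⟩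
    refine le_antisymm ?_ (not_lt.1 fun hlt => hn ((h.mem_iff y hy).2 hlt))
    have h1 : y ∈ closure (Metric.ball x r ∩ D) := Metric.isOpen_ball.inter_closure ⟨hy, hcl⟩
    have h2 : IsClosed {z : Plane | φ (T z 0) ≤ T z 1} :=
      isClosed_le (by fun_prop) (by fun_prop)
    exact closure_minimal (fun z hz => ((h.mem_iff z hz.1).1 hz.2).le) h2 h1
  · intro heq
    refine ⟨?_, fun hD => heq.not_lt ((h.mem_iff y hy).1 hD)⟩
    -- approach `y` vertically from above the graph
    have hlim : Tendsto (fun t : ℝ => T.symm (T y + t • (!₂[0, 1] : Plane))) (𝓝[>] 0) (𝓝 y) := by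
      have hc : Continuous fun t : ℝ => T.symm (T y + t • (!₂[0, 1] : Plane)) :=
        T.symm.continuous.comp (by fun_prop)
      have := hc.tendsto 0
      simp only [zero_smul, add_zero, AffineIsometryEquiv.symm_apply_apply] at this
      exact this.mono_left nhdsWithin_le_nhds
    refine mem_closure_of_tendsto hlim ?_
    filter_upwards [hlim (Metric.isOpen_ball.mem_nhds hy), self_mem_nhdsWithin] with t ht ht0
    refine (h.mem_iff _ ht).2 ?_
    have ht0' : (0 : ℝ) < t := ht0
    simp [heq, ht0']

theorem isOuterNormal (h : IsGraphChart D x r T φ L) {s : ℝ}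
    (hs : DifferentiableAt ℝ φ s) (hmem : T.symm (graphPoint φ s) ∈ Metric.ball x r) :
    IsOuterNormal D (T.symm (graphPoint φ s))
      (T.symm.linearIsometryEquiv (graphNormal φ s)) := by
  refine ⟨by rw [LinearIsometryEquiv.norm_map, norm_graphNormal], fun ε hε => ?_⟩
  have hT : Tendsto T (𝓝 (T.symm (graphPoint φ s))) (𝓝 (graphPoint φ s)) := by
    have := T.continuous.tendsto (T.symm (graphPoint φ s))
    rwa [AffineIsometryEquiv.apply_symm_apply] at this
  filter_upwards [hT.eventually (eventually_graphNormal_bounds hs hε),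
    Metric.isOpen_ball.mem_nhds hmem] with y hy hyb
  have hsub : y - T.symm (graphPoint φ s)
      = T.symm.linearIsometryEquiv (T y - graphPoint φ s) := by
    have := T.symm.map_vsub (T y) (graphPoint φ s)
    simp only [vsub_eq_sub, AffineIsometryEquiv.symm_apply_apply] at this
    exact this.symm
  rw [hsub, LinearIsometryEquiv.inner_map_map, LinearIsometryEquiv.norm_map, h.mem_iff y hyb,
    not_lt]
  exact hy

theorem map_graph (h : IsGraphChart D x r T φ L) :
    (Measure.hausdorffMeasure 1).restrict {y | φ (T y 0) = T y 1}
      = (volume.withDensity fun s => ENNReal.ofReal (graphSpeed φ s)).map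
        (fun s => T.symm (graphPoint φ s)) := by
  have h1 := hausdorffMeasure_restrict_range_graphPoint h.lipschitz
  have hset : {y | φ (T y 0) = T y 1} = T.symm.toIsometryEquiv.symm ⁻¹' range (graphPoint φ) := by
    ext y
    constructor
    · intro hy
      refine ⟨T y 0, ?_⟩
      ext i
      fin_cases i
      · rfl
      · exact hy
    · rintro ⟨s, hs⟩
      have hs' : T y = graphPoint φ s := hs.symm
      simp [hs']
  have h2 := T.symm.toIsometryEquiv.map_hausdorffMeasure 1
  have hm : Measurable T.symm.toIsometryEquiv := T.symm.toIsometryEquiv.continuous.measurable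
  have hms : MeasurableSet {y : Plane | φ (T y 0) = T y 1} := by
    have hφ := h.lipschitz.continuous
    have hT : Continuous T := T.continuous
    exact (isClosed_eq (by fun_prop) (by fun_prop)).measurableSet
  rw [← h2, Measure.restrict_map hm hms]
  have h3 : T.symm.toIsometryEquiv ⁻¹' {y | φ (T y 0) = T y 1} = range (graphPoint φ) := by
    rw [hset, ← preimage_comp]
    convert preimage_id
    ext1 y
    simp
  rw [h3, h1, Measure.map_map hm (measurableEmbedding_graphPoint h.lipschitz.continuous).measurable]
  rfl

/-- In a graph chart, arc length on `∂D` is the image of `√(1 + φ'²) ds`. -/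
theorem arcLength_restrict_ball (h : IsGraphChart D x r T φ L) :
    (arcLength D).restrict (Metric.ball x r)
      = ((volume.withDensity fun s => ENNReal.ofReal (graphSpeed φ s)).map
        (fun s => T.symm (graphPoint φ s))).restrict (Metric.ball x r) := by
  rw [← h.map_graph, arcLength, Measure.restrict_restrict Metric.isOpen_ball.measurableSet,
    Measure.restrict_restrict Metric.isOpen_ball.measurableSet]
  congr 1
  ext y
  constructor
  · exact fun hy => ⟨hy.1, (h.mem_frontier_iff hy.1).1 hy.2⟩
  · exact fun hy => ⟨hy.1, (h.mem_frontier_iff hy.1).2 hy.2⟩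

theorem measurableEmbedding (h : IsGraphChart D x r T φ L) :
    MeasurableEmbedding (fun s => T.symm (graphPoint φ s)) :=
  T.symm.toHomeomorph.measurableEmbedding.comp
    (measurableEmbedding_graphPoint h.lipschitz.continuous)

theorem abs_deriv_le (h : IsGraphChart D x r T φ L) (s : ℝ) : |deriv φ s| ≤ L :=
  norm_deriv_le_of_lipschitz h.lipschitz

theorem graphSpeed_le (h : IsGraphChart D x r T φ L) (s : ℝ) : graphSpeed φ s ≤ 1 + L := by
  rw [graphSpeed, Real.sqrt_le_left (by positivity)]
  have h1 := h.abs_deriv_le s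
  have h2 : deriv φ s ^ 2 ≤ L ^ 2 := sq_le_sq' (by linarith [(abs_le.1 h1).1]) (abs_le.1 h1).2
  have h3 : (0 : ℝ) ≤ L := L.2
  nlinarith

theorem arcLength_ball_lt_top (h : IsGraphChart D x r T φ L) :
    arcLength D (Metric.ball x r) < ⊤ := by
  rw [← Measure.restrict_apply_univ, h.arcLength_restrict_ball, Measure.restrict_apply_univ,
    h.measurableEmbedding.map_apply, withDensity_apply _
    (h.measurableEmbedding.measurable Metric.isOpen_ball.measurableSet)]
  have hsub : (fun s => T.symm (graphPoint φ s)) ⁻¹' Metric.ball x r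
      ⊆ Metric.closedBall (T x 0) r := by
    intro s hs
    have h1 : dist (graphPoint φ s) (T x) < r := by
      have := T.symm.dist_map (graphPoint φ s) (T x)
      rw [AffineIsometryEquiv.symm_apply_apply] at this
      rw [← this]
      exact hs
    rw [Metric.mem_closedBall, Real.dist_eq]
    exact (abs_apply_le_norm (graphPoint φ s - T x) 0).trans (by rw [← dist_eq_norm]; exact h1.le)
  calc _ ≤ ∫⁻ s in Metric.closedBall (T x 0) r, ENNReal.ofReal (1 + L) :=
        (lintegral_mono' (Measure.restrict_mono hsub le_rfl)
          fun s => ENNReal.ofReal_le_ofReal (h.graphSpeed_le s))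
    _ < ⊤ := by
        rw [setLIntegral_const]
        exact ENNReal.mul_lt_top ENNReal.ofReal_lt_top
          (isCompact_closedBall _ _).measure_lt_top

/-- Transfer of almost-everywhere statements along the parametrization of the boundary. -/
theorem ae_of_ae (h : IsGraphChart D x r T φ L) {P : Plane → Prop}
    (hP : ∀ᵐ s, T.symm (graphPoint φ s) ∈ Metric.ball x r → P (T.symm (graphPoint φ s))) :
    ∀ᵐ y ∂(arcLength D).restrict (Metric.ball x r), P y := by
  rw [h.arcLength_restrict_ball, ae_restrict_iff' Metric.isOpen_ball.measurableSet,
    h.measurableEmbedding.ae_map_iff]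
  exact (withDensity_absolutelyContinuous _ _).ae_le hP

theorem ae_outerNormal (h : IsGraphChart D x r T φ L) :
    ∀ᵐ s, T.symm (graphPoint φ s) ∈ Metric.ball x r →
      IsOuterNormal D (T.symm (graphPoint φ s)) (T.symm.linearIsometryEquiv (graphNormal φ s)) := by
  filter_upwards [h.lipschitz.ae_differentiableAt] with s hs hmem
  exact h.isOuterNormal hs hmem

/-- The divergence theorem in `D` for the field `f e` with `f` supported in a graph chart. -/
theorem integral_fderiv (h : IsGraphChart D x r T φ L) {f : Plane → ℂ} (hf : ContDiff ℝ 1 f)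
    (hsupp : tsupport f ⊆ Metric.ball x r) (e : Plane) :
    ∫ y in D, fderiv ℝ f y e
      = ∫ y, ((inner ℝ (outerNormal D y) e : ℝ) : ℂ) * f y ∂(arcLength D) := by
  have hfz : ∀ y, y ∉ Metric.ball x r → f y = 0 := fun y hy =>
    image_eq_zero_of_notMem_tsupport fun hy' => hy (hsupp hy')
  have hfdz : ∀ y, y ∉ Metric.ball x r → fderiv ℝ f y = 0 := fun y hy =>
    image_eq_zero_of_notMem_tsupport fun hy' => hy (hsupp (tsupport_fderiv_subset ℝ hy'))
  have hc : HasCompactSupport f :=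
    (isCompact_closedBall x r).of_isClosed_subset (isClosed_tsupport f)
      (hsupp.trans Metric.ball_subset_closedBall)
  -- the left side: pass to the coordinates `T`
  have hl : ∫ y in D, fderiv ℝ f y e
      = ∫ w in epigraph φ, fderiv ℝ (f ∘ T.symm) w (T.linearIsometryEquiv e) := by
    have hmp : MeasurePreserving T (volume.restrict (T ⁻¹' epigraph φ))
        (volume.restrict (epigraph φ)) :=
      (measurePreserving_affineIsometryEquiv T).restrict_preimage
        (isOpen_epigraph h.lipschitz.continuous).measurableSet
    rw [← hmp.integral_comp T.toHomeomorph.measurableEmbedding,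
      ← integral_indicator h.isOpen.measurableSet,
      ← integral_indicator (T.continuous.measurable
        (isOpen_epigraph h.lipschitz.continuous).measurableSet)]
    congr 1
    funext y
    have hfd : fderiv ℝ (f ∘ T.symm) (T y) (T.linearIsometryEquiv e) = fderiv ℝ f y e := by
      have hT := hasFDerivAt_affineIsometryEquiv T.symm (T y)
      have h2 : HasFDerivAt f (fderiv ℝ f y) (T.symm (T y)) := by
        rw [AffineIsometryEquiv.symm_apply_apply]
        exact (hf.differentiable one_ne_zero y).hasFDerivAt
      rw [(h2.comp (T y) hT).fderiv]
      change fderiv ℝ f y (T.symm.linearIsometryEquiv (T.linearIsometryEquiv e)) = _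
      congr 1
      exact LinearIsometryEquiv.symm_apply_apply T.linearIsometryEquiv e
    by_cases hy : y ∈ Metric.ball x r
    · by_cases hyD : y ∈ D
      · have hyT : y ∈ T ⁻¹' epigraph φ := (h.mem_iff y hy).1 hyD
        rw [indicator_of_mem hyD, indicator_of_mem hyT, hfd]
      · have hyT : y ∉ T ⁻¹' epigraph φ := fun hy' => hyD ((h.mem_iff y hy).2 hy')
        rw [indicator_of_notMem hyD, indicator_of_notMem hyT]
    · have h0 : fderiv ℝ f y e = 0 := by rw [hfdz y hy]; rfl
      refine (indicator_apply_eq_zero.2 ?_).trans (indicator_apply_eq_zero.2 ?_).symm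
      · exact fun _ => h0
      · exact fun _ => hfd.trans h0
  have hTs : ContDiff ℝ 1 (f ∘ T.symm) := hf.comp (contDiff_affineIsometryEquiv T.symm)
  rw [hl, integral_epigraph_fderiv h.lipschitz hTs (hc.comp_homeomorph T.symm.toHomeomorph)]
  -- the right side: parametrize the boundary
  set G : Plane → ℂ := fun y => ((inner ℝ (outerNormal D y) e : ℝ) : ℂ) * f y with hG
  have hGz : ∀ y, y ∉ Metric.ball x r → G y = 0 := fun y hy => by simp [hG, hfz y hy]
  have hr : ∫ y, G y ∂(arcLength D) = ∫ s, graphSpeed φ s • G (T.symm (graphPoint φ s)) := by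
    rw [← setIntegral_eq_integral_of_forall_compl_eq_zero hGz, h.arcLength_restrict_ball,
      setIntegral_eq_integral_of_forall_compl_eq_zero hGz, h.measurableEmbedding.integral_map,
      integral_withDensity_eq_integral_toReal_smul (measurable_graphSpeed φ).ennreal_ofReal
        (Eventually.of_forall fun _ => ENNReal.ofReal_lt_top)]
    simp only [ENNReal.toReal_ofReal (graphSpeed_pos φ _).le]
  rw [hr]
  refine integral_congr_ae ?_
  filter_upwards [h.ae_outerNormal] with s hs
  by_cases hmem : T.symm (graphPoint φ s) ∈ Metric.ball x r
  · simp only [hG, (hs hmem).outerNormal_eq, inner_map_graphNormal, Function.comp_apply,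
      Complex.real_smul]
    rw [← mul_assoc, ← Complex.ofReal_mul, ← mul_assoc, mul_inv_cancel₀ (graphSpeed_pos φ s).ne',
      one_mul]
  · rw [hGz _ hmem, smul_zero, Function.comp_apply, hfz _ hmem, mul_zero]

theorem aestronglyMeasurable_outerNormal (h : IsGraphChart D x r T φ L) :
    AEStronglyMeasurable (outerNormal D) ((arcLength D).restrict (Metric.ball x r)) := by
  have hm : Measurable fun y : Plane => T.symm.linearIsometryEquiv (graphNormal φ (T y 0)) := by
    refine T.symm.linearIsometryEquiv.continuous.measurable.comp
      ((measurable_graphNormal φ).comp ?_)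
    have hT : Continuous T := T.continuous
    exact (by fun_prop : Continuous fun y : Plane => T y 0).measurable
  refine ⟨_, hm.stronglyMeasurable, h.ae_of_ae ?_⟩
  filter_upwards [h.ae_outerNormal] with s hs hmem
  rw [(hs hmem).outerNormal_eq]
  simp

end IsGraphChart

/-! ### The divergence theorem and the trace inequality in a Lipschitz domain -/

/-- `U` is an open set in which the divergence theorem for `D` is available, and in which the
outward normal to `D` stays in the half-plane `⟪n, e⟫ ≥ c`. The domain `D` itself is such a patch,
with any `e` and any `c > 0`, because it does not meet its boundary. -/
structure IsDivergencePatch (D U : Set Plane) (e : Plane) (c : ℝ) : Prop where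
  isOpen : IsOpen U
  pos : 0 < c
  arcLength_lt_top : arcLength D U < ⊤
  measurable_normal : AEStronglyMeasurable (outerNormal D) ((arcLength D).restrict U)
  transversal : ∀ᵐ y ∂(arcLength D).restrict U, c ≤ inner ℝ (outerNormal D y) e
  integral_fderiv : ∀ f : Plane → ℂ, ContDiff ℝ 1 f → tsupport f ⊆ U → ∀ w : Plane,
    ∫ y in D, fderiv ℝ f y w = ∫ y, ((inner ℝ (outerNormal D y) w : ℝ) : ℂ) * f y ∂(arcLength D)

/-- In a graph chart the downward direction is transversal: its product with the outward normal is
`1 / √(1 + φ'²) ≥ 1 / (1 + L)`. -/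
theorem IsGraphChart.isDivergencePatch {D : Set Plane} {x : Plane} {r : ℝ}
    {T : Plane ≃ᵃⁱ[ℝ] Plane} {φ : ℝ → ℝ} {L : ℝ≥0} (h : IsGraphChart D x r T φ L) :
    IsDivergencePatch D (Metric.ball x r) (T.symm.linearIsometryEquiv !₂[0, -1]) (1 + L)⁻¹ where
  isOpen := Metric.isOpen_ball
  pos := by positivity
  arcLength_lt_top := h.arcLength_ball_lt_top
  measurable_normal := h.aestronglyMeasurable_outerNormal
  transversal := by
    refine h.ae_of_ae ?_
    filter_upwards [h.ae_outerNormal] with s hs hmem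
    rw [(hs hmem).outerNormal_eq, LinearIsometryEquiv.inner_map_map, inner_graphNormal]
    simpa using inv_anti₀ (graphSpeed_pos φ s) (h.graphSpeed_le s)
  integral_fderiv := fun f hf hs w => h.integral_fderiv hf hs w

theorem integral_fderiv_eq_zero {f : Plane → ℂ} (hf : ContDiff ℝ 1 f) (hc : HasCompactSupport f)
    (w : Plane) : ∫ y, fderiv ℝ f y w = 0 := by
  have h := integral_mul_fderiv_eq_neg_fderiv_mul_of_integrable (μ := (volume : Measure Plane))
    (f := fun _ => (1 : ℂ)) (g := f) (v := w) (by simp)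
    (by simpa using ((hf.continuous_fderiv one_ne_zero).clm_apply
      continuous_const).integrable_of_hasCompactSupport (hc.fderiv_apply ℝ w))
    (by simpa using hf.continuous.integrable_of_hasCompactSupport hc)
    (fun x _ => differentiableAt_const _) (fun x _ => hf.differentiable one_ne_zero x)
  simpa using h

theorem ae_mem_frontier (D : Set Plane) : ∀ᵐ y ∂(arcLength D), y ∈ frontier D :=
  ae_restrict_mem isClosed_frontier.measurableSet

theorem continuous_fderiv_apply {F : Type*} [NormedAddCommGroup F] [NormedSpace ℝ F]
    {f : Plane → F} (hf : ContDiff ℝ 1 f) (w : Plane) : Continuous fun y => fderiv ℝ f y w :=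
  (hf.continuous_fderiv one_ne_zero).clm_apply continuous_const

theorem fderiv_apply_eq_sum_partialDeriv {f : Plane → ℂ} (y w : Plane) :
    fderiv ℝ f y w = ∑ i, (w i : ℂ) * partialDeriv i f y := by
  have : w = ∑ i, w i • EuclideanSpace.single i (1 : ℝ) := by
    ext j
    fin_cases j <;> simp [Fin.sum_univ_two]
  conv_lhs => rw [this]
  simp [partialDeriv, Fin.sum_univ_two]

namespace IsLipschitzDomain

variable {D : Set Plane}

theorem isCompact_closure (hD : IsLipschitzDomain D) : IsCompact (closure D) :=
  hD.isBounded.isCompact_closure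

theorem isDivergencePatch_self (hD : IsLipschitzDomain D) : IsDivergencePatch D D 0 1 := by
  have h0 : (arcLength D).restrict D = 0 := by
    rw [arcLength, Measure.restrict_restrict hD.isOpen.measurableSet,
      hD.isOpen.inter_frontier_eq, Measure.restrict_empty]
  have hm : (arcLength D) D = 0 := by rw [← Measure.restrict_apply_univ, h0]; rfl
  refine ⟨hD.isOpen, one_pos, by simp [hm], by simp [h0], by simp [h0], fun f hf hs w => ?_⟩
  have hfz : ∀ y, y ∉ D → f y = 0 := fun y hy =>
    image_eq_zero_of_notMem_tsupport fun hy' => hy (hs hy')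
  have hfdz : ∀ y, y ∉ D → fderiv ℝ f y w = 0 := fun y hy => by
    rw [image_eq_zero_of_notMem_tsupport fun hy' => hy (hs (tsupport_fderiv_subset ℝ hy'))]
    rfl
  have hc : HasCompactSupport f :=
    hD.isCompact_closure.of_isClosed_subset (isClosed_tsupport f) (hs.trans subset_closure)
  rw [setIntegral_eq_integral_of_forall_compl_eq_zero hfdz, integral_fderiv_eq_zero hf hc,
    ← setIntegral_eq_integral_of_forall_compl_eq_zero (s := D) (fun y hy => by simp [hfz y hy]),
    h0, integral_zero_measure]

theorem exists_isDivergencePatch (hD : IsLipschitzDomain D) {x : Plane} (hx : x ∈ closure D) :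
    ∃ U e c, x ∈ U ∧ IsDivergencePatch D U e c := by
  by_cases hxD : x ∈ D
  · exact ⟨D, 0, 1, hxD, hD.isDivergencePatch_self⟩
  · have hxf : x ∈ frontier D := by
      rw [hD.isOpen.frontier_eq]
      exact ⟨hx, hxD⟩
    obtain ⟨T, φ, L, r, hr, hφ, hT⟩ := hD.lipschitz x hxf
    have h : IsGraphChart D x r T φ L := ⟨hD.isOpen, hφ, hT⟩
    exact ⟨_, _, _, Metric.mem_ball_self hr, h.isDivergencePatch⟩

/-- A finite smooth partition of unity on `closure D`, subordinate to divergence patches. -/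
theorem exists_partition (hD : IsLipschitzDomain D) :
    ∃ (ι : Type) (_ : Fintype ι) (U : ι → Set Plane) (e : ι → Plane) (c : ι → ℝ)
      (ρ : ι → Plane → ℝ), (∀ i, IsDivergencePatch D (U i) (e i) (c i)) ∧
      (∀ i, ContDiff ℝ ∞ (ρ i) ∧ tsupport (ρ i) ⊆ U i ∧ ∀ y, 0 ≤ ρ i y) ∧
      ∀ y ∈ closure D, ∑ i, ρ i y = 1 := by
  choose! U e c hxU hU using fun x (hx : x ∈ closure D) => hD.exists_isDivergencePatch hx
  obtain ⟨t, htD, ht⟩ := hD.isCompact_closure.elim_nhds_subcover U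
    fun x hx => (hU x hx).isOpen.mem_nhds (hxU x hx)
  obtain ⟨f, hf⟩ := SmoothPartitionOfUnity.exists_isSubordinate (modelWithCornersSelf ℝ Plane)
    isClosed_closure (fun i : t => U i) (fun i => (hU i (htD i i.2)).isOpen)
    (ht.trans (by simp [iUnion_subtype]))
  refine ⟨t, inferInstance, fun i => U i, fun i => e i, fun i => c i, fun i => f i,
    fun i => hU i (htD i i.2), fun i => ⟨contMDiff_iff_contDiff.1 (f i).contMDiff, hf i,
      f.nonneg i⟩, fun y hy => ?_⟩
  rw [← finsum_eq_sum_of_fintype]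
  exact f.sum_eq_one hy

/-- The boundary of a bounded Lipschitz domain has finite length. -/
theorem isFiniteMeasure_arcLength (hD : IsLipschitzDomain D) : IsFiniteMeasure (arcLength D) := by
  obtain ⟨ι, _, U, e, c, ρ, hU, hρ, hsum⟩ := hD.exists_partition
  refine ⟨?_⟩
  have hcov : (univ : Set Plane) ⊆ (frontier D)ᶜ ∪ ⋃ i, U i := by
    intro y _
    by_cases hy : y ∈ frontier D
    · right
      obtain ⟨i, -, hi⟩ := Finset.exists_ne_zero_of_sum_ne_zero
        (by rw [hsum y (frontier_subset_closure hy)]; exact one_ne_zero)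
      exact mem_iUnion.2 ⟨i, (hρ i).2.1 (subset_tsupport _ hi)⟩
    · exact Or.inl hy
  refine (measure_mono hcov).trans_lt ((measure_union_le _ _).trans_lt ?_)
  have h0 : arcLength D (frontier D)ᶜ = 0 := ae_iff.1 (ae_mem_frontier D)
  rw [h0, zero_add]
  refine (measure_iUnion_le _).trans_lt ?_
  rw [tsum_fintype]
  exact ENNReal.sum_lt_top.2 fun i _ => (hU i).arcLength_lt_top

theorem aestronglyMeasurable_outerNormal (hD : IsLipschitzDomain D) :
    AEStronglyMeasurable (outerNormal D) (arcLength D) := by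
  obtain ⟨ι, _, U, e, c, ρ, hU, hρ, hsum⟩ := hD.exists_partition
  have h := AEStronglyMeasurable.iUnion fun i => (hU i).measurable_normal
  rwa [Measure.restrict_eq_self_of_ae_mem] at h
  filter_upwards [ae_mem_frontier D] with y hy
  obtain ⟨i, -, hi⟩ := Finset.exists_ne_zero_of_sum_ne_zero
    (by rw [hsum y (frontier_subset_closure hy)]; exact one_ne_zero)
  exact mem_iUnion.2 ⟨i, (hρ i).2.1 (subset_tsupport _ hi)⟩

theorem memLp_arcLength (hD : IsLipschitzDomain D) {F : Type*} [NormedAddCommGroup F]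
    {f : Plane → F} (hf : AEStronglyMeasurable f (arcLength D)) {M : ℝ}
    (hM : ∀ y ∈ frontier D, ‖f y‖ ≤ M) (p : ℝ≥0∞) : MemLp f p (arcLength D) :=
  haveI := hD.isFiniteMeasure_arcLength
  MemLp.of_bound hf M ((ae_mem_frontier D).mono hM)

theorem memLp_arcLength_of_continuous (hD : IsLipschitzDomain D) {F : Type*}
    [NormedAddCommGroup F] [SecondCountableTopology F] {f : Plane → F} (hf : Continuous f)
    (p : ℝ≥0∞) : MemLp f p (arcLength D) := by
  obtain ⟨M, hM⟩ := hD.isCompact_closure.exists_bound_of_continuousOn hf.continuousOn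
  exact hD.memLp_arcLength hf.aestronglyMeasurable
    (fun y hy => hM y (frontier_subset_closure hy)) p

theorem integrableOn_of_continuous (hD : IsLipschitzDomain D) {F : Type*}
    [NormedAddCommGroup F] {f : Plane → F} (hf : Continuous f) : IntegrableOn f D :=
  (hf.continuousOn.integrableOn_compact hD.isCompact_closure).mono_set subset_closure

theorem integrable_inner_normal_mul (hD : IsLipschitzDomain D) (w : Plane) {f : Plane → ℂ}
    (hf : Continuous f) :
    Integrable (fun y => ((inner ℝ (outerNormal D y) w : ℝ) : ℂ) * f y) (arcLength D) := by
  refine (memLp_one_iff_integrable.1 (hD.memLp_arcLength_of_continuous hf 1)).bdd_mul (c := ‖w‖)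
    (Complex.continuous_ofReal.comp_aestronglyMeasurable
      (hD.aestronglyMeasurable_outerNormal.inner aestronglyMeasurable_const))
    (Eventually.of_forall fun y => ?_)
  rw [Complex.norm_real]
  refine (norm_inner_le_norm _ _).trans ?_
  exact mul_le_of_le_one_left (norm_nonneg _) (norm_outerNormal_le D y)

/-- The divergence theorem in a bounded Lipschitz domain, for the field `f w`. -/
theorem integral_fderiv (hD : IsLipschitzDomain D) {f : Plane → ℂ} (hf : ContDiff ℝ 1 f)
    (w : Plane) :
    ∫ y in D, fderiv ℝ f y w
      = ∫ y, ((inner ℝ (outerNormal D y) w : ℝ) : ℂ) * f y ∂(arcLength D) := by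
  obtain ⟨ι, _, U, e, c, ρ, hU, hρ, hsum⟩ := hD.exists_partition
  have hfi : ∀ i, ContDiff ℝ 1 fun y => (ρ i y : ℂ) * f y := fun i =>
    (Complex.ofRealCLM.contDiff.comp ((hρ i).1.of_le (by exact_mod_cast le_top))).mul hf
  have hsupp : ∀ i, tsupport (fun y => (ρ i y : ℂ) * f y) ⊆ U i := fun i =>
    (closure_mono fun y hy => by
      have : (ρ i y : ℂ) ≠ 0 := left_ne_zero_of_mul hy
      exact_mod_cast this).trans (hρ i).2.1
  have hsumf : ∀ y ∈ closure D, ∑ i, (ρ i y : ℂ) * f y = f y := fun y hy => by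
    rw [← Finset.sum_mul, ← Complex.ofReal_sum, hsum y hy, Complex.ofReal_one, one_mul]
  have hl : ∫ y in D, fderiv ℝ f y w
      = ∑ i, ∫ y in D, fderiv ℝ (fun y => (ρ i y : ℂ) * f y) y w := by
    rw [← integral_finsetSum _ fun i _ =>
      (hD.integrableOn_of_continuous (continuous_fderiv_apply (hfi i) w))]
    refine setIntegral_congr_fun hD.isOpen.measurableSet fun y hy => ?_
    have heq : f =ᶠ[𝓝 y] fun y => ∑ i, (ρ i y : ℂ) * f y := by
      filter_upwards [hD.isOpen.mem_nhds hy] with z hz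
      exact (hsumf z (subset_closure hz)).symm
    rw [heq.fderiv_eq, fderiv_fun_sum fun i _ => (hfi i).differentiable one_ne_zero y,
      _root_.sum_apply]
  rw [hl, Finset.sum_congr rfl fun i _ => (hU i).integral_fderiv _ (hfi i) (hsupp i) w,
    ← integral_finsetSum _ fun i _ => hD.integrable_inner_normal_mul w (hfi i).continuous]
  refine integral_congr_ae ?_
  filter_upwards [ae_mem_frontier D] with y hy
  rw [← Finset.mul_sum, hsumf y (frontier_subset_closure hy)]

/-- The boundary `L²` norm of a `C¹` function is controlled by its `H¹` norm: apply the divergence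
theorem to the fields `ρ |f|² e`, where `e` is transversal to the boundary on the support
of `ρ`. -/
theorem exists_trace_bound (hD : IsLipschitzDomain D) :
    ∃ C : ℝ, 0 ≤ C ∧ ∀ f : Plane → ℂ, ContDiff ℝ 1 f →
      ∫ y, ‖f y‖ ^ 2 ∂(arcLength D) ≤
        C * ((∫ y in D, ‖f y‖ ^ 2) + ∑ i, ∫ y in D, ‖partialDeriv i f y‖ ^ 2) := by
  obtain ⟨ι, _, U, e, c, ρ, hU, hρ, hsum⟩ := hD.exists_partition
  have hρ1 : ∀ i, ContDiff ℝ 1 (ρ i) := fun i => (hρ i).1.of_le (by exact_mod_cast le_top)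
  choose A hA using fun i => hD.isCompact_closure.exists_bound_of_continuousOn
    (hρ i).1.continuous.continuousOn
  choose B hB using fun i => hD.isCompact_closure.exists_bound_of_continuousOn
    (continuous_fderiv_apply (hρ1 i) (e i)).continuousOn
  -- `|∂ₑ(ρ |f|²)| ≤ B |f|² + A (|f|² + |∂ₑ f|²)` and `|∂ₑ f|² ≤ 2 |e|² (|∂₁f|² + |∂₂f|²)`
  set K : ι → ℝ := fun i => (c i)⁻¹ * (|B i| + |A i| * (1 + 2 * ‖e i‖ ^ 2)) with hK
  have hK0 : ∀ i, 0 ≤ K i := fun i => by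
    have := (hU i).pos
    positivity
  refine ⟨∑ i, K i, Finset.sum_nonneg fun i _ => hK0 i, fun f hf => ?_⟩
  have hn : ContDiff ℝ 1 fun y => ‖f y‖ ^ 2 := hf.norm_sq ℝ
  have hg : ∀ i, ContDiff ℝ 1 fun y => ρ i y * ‖f y‖ ^ 2 := fun i => (hρ1 i).mul hn
  have hpc : ∀ j, Continuous fun y => ‖partialDeriv j f y‖ ^ 2 := fun j =>
    (continuous_fderiv_apply hf _).norm.pow 2
  set E : Plane → ℝ := fun y => ‖f y‖ ^ 2 + ∑ j, ‖partialDeriv j f y‖ ^ 2 with hE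
  have hEc : Continuous E := hn.continuous.add (continuous_finsetSum _ fun j _ => hpc j)
  have hEint : ∫ y in D, E y
      = (∫ y in D, ‖f y‖ ^ 2) + ∑ j, ∫ y in D, ‖partialDeriv j f y‖ ^ 2 := by
    rw [integral_add (hD.integrableOn_of_continuous hn.continuous)
      (hD.integrableOn_of_continuous (continuous_finsetSum _ fun j _ => hpc j)),
      integral_finsetSum _ fun j _ => hD.integrableOn_of_continuous (hpc j)]
  rw [← hEint]
  have hdir : ∀ i y, ‖fderiv ℝ f y (e i)‖ ^ 2 ≤ 2 * ‖e i‖ ^ 2 * ∑ j, ‖partialDeriv j f y‖ ^ 2 := by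
    intro i y
    rw [fderiv_apply_eq_sum_partialDeriv, Fin.sum_univ_two, Fin.sum_univ_two]
    set a := ‖partialDeriv 0 f y‖
    set b := ‖partialDeriv 1 f y‖
    have h0 := abs_apply_le_norm (e i) 0
    have h1 := abs_apply_le_norm (e i) 1
    have h2 : ‖((e i 0 : ℝ) : ℂ) * partialDeriv 0 f y + ((e i 1 : ℝ) : ℂ) * partialDeriv 1 f y‖
        ≤ ‖e i‖ * (a + b) := by
      refine (norm_add_le _ _).trans ?_
      rw [norm_mul, norm_mul, Complex.norm_real, Complex.norm_real, Real.norm_eq_abs,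
        Real.norm_eq_abs, mul_add]
      gcongr
    calc _ ≤ (‖e i‖ * (a + b)) ^ 2 := by gcongr
      _ = ‖e i‖ ^ 2 * (a + b) ^ 2 := by ring
      _ ≤ ‖e i‖ ^ 2 * (2 * (a ^ 2 + b ^ 2)) := by
        gcongr
        nlinarith [sq_nonneg (a - b)]
      _ = _ := by ring
  have hbound : ∀ i, ∀ y ∈ D, fderiv ℝ (fun y => ρ i y * ‖f y‖ ^ 2) y (e i)
      ≤ (|B i| + |A i| * (1 + 2 * ‖e i‖ ^ 2)) * E y := by
    intro i y hy
    have hyc := subset_closure hy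
    have hf' := (hf.differentiable one_ne_zero y).hasFDerivAt
    have hρ' := ((hρ1 i).differentiable one_ne_zero y).hasFDerivAt
    have hder : fderiv ℝ (fun y => ρ i y * ‖f y‖ ^ 2) y = _ := (hρ'.mul hf'.norm_sq).fderiv
    rw [hder]
    simp only [_root_.add_apply, _root_.smul_apply, ContinuousLinearMap.comp_apply, smul_eq_mul,
      innerSL_apply_apply]
    set S := ∑ j, ‖partialDeriv j f y‖ ^ 2 with hS
    have hS0 : 0 ≤ S := Finset.sum_nonneg fun j _ => by positivity
    have h1 : |ρ i y| ≤ |A i| := (hA i y hyc).trans (le_abs_self _)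
    have h2 : |fderiv ℝ (ρ i) y (e i)| ≤ |B i| := (hB i y hyc).trans (le_abs_self _)
    have h3 : |inner ℝ (f y) (fderiv ℝ f y (e i))| ≤ ‖f y‖ * ‖fderiv ℝ f y (e i)‖ :=
      abs_real_inner_le_norm _ _
    have h4 : 2 * |inner ℝ (f y) (fderiv ℝ f y (e i))| ≤ ‖f y‖ ^ 2 + 2 * ‖e i‖ ^ 2 * S := by
      have := hdir i y
      nlinarith [sq_nonneg (‖f y‖ - ‖fderiv ℝ f y (e i)‖)]
    have h5 : ρ i y * (2 * inner ℝ (f y) (fderiv ℝ f y (e i)))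
        ≤ |A i| * (‖f y‖ ^ 2 + 2 * ‖e i‖ ^ 2 * S) := by
      refine (le_abs_self _).trans ?_
      rw [abs_mul, abs_mul, abs_two]
      gcongr
    have h6 : ‖f y‖ ^ 2 * fderiv ℝ (ρ i) y (e i) ≤ |B i| * ‖f y‖ ^ 2 := by
      rw [mul_comm]
      gcongr
      exact (le_abs_self _).trans h2
    have h7 : (|B i| + |A i| * (1 + 2 * ‖e i‖ ^ 2)) * E y
        = |B i| * ‖f y‖ ^ 2 + |A i| * (‖f y‖ ^ 2 + 2 * ‖e i‖ ^ 2 * S)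
          + (|B i| * S + |A i| * (S + 2 * ‖e i‖ ^ 2 * ‖f y‖ ^ 2)) := by
      rw [hE]
      ring
    have h8 : 0 ≤ |B i| * S + |A i| * (S + 2 * ‖e i‖ ^ 2 * ‖f y‖ ^ 2) := by positivity
    rw [h7]
    simp only [nsmul_eq_mul, Nat.cast_ofNat]
    linarith
  have hpatch : ∀ i, ∫ y, ρ i y * ‖f y‖ ^ 2 ∂(arcLength D) ≤ K i * ∫ y in D, E y := by
    intro i
    have hc := (hU i).pos
    have hgi : Integrable (fun y => ρ i y * ‖f y‖ ^ 2) (arcLength D) :=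
      memLp_one_iff_integrable.1 (hD.memLp_arcLength_of_continuous (hg i).continuous 1)
    have hgC : ContDiff ℝ 1 fun y => ((ρ i y * ‖f y‖ ^ 2 : ℝ) : ℂ) :=
      Complex.ofRealCLM.contDiff.comp (hg i)
    have hsupp : tsupport (fun y => ((ρ i y * ‖f y‖ ^ 2 : ℝ) : ℂ)) ⊆ U i :=
      (closure_mono fun y hy => by
        have : ρ i y * ‖f y‖ ^ 2 ≠ 0 := Complex.ofReal_ne_zero.1 hy
        exact left_ne_zero_of_mul this).trans (hρ i).2.1
    have hdiv := (hU i).integral_fderiv _ hgC hsupp (e i)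
    have hdivR : ∫ y in D, fderiv ℝ (fun y => ρ i y * ‖f y‖ ^ 2) y (e i)
        = ∫ y, inner ℝ (outerNormal D y) (e i) * (ρ i y * ‖f y‖ ^ 2) ∂(arcLength D) := by
      have h1 : ∀ y, fderiv ℝ (fun y => ((ρ i y * ‖f y‖ ^ 2 : ℝ) : ℂ)) y (e i)
          = ((fderiv ℝ (fun y => ρ i y * ‖f y‖ ^ 2) y (e i) : ℝ) : ℂ) := fun y => by
        have := (Complex.ofRealCLM.hasFDerivAt.comp y
          ((hg i).differentiable one_ne_zero y).hasFDerivAt).fderiv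
        exact congrArg (fun T => T (e i)) this
      simp only [h1, ← Complex.ofReal_mul] at hdiv
      rw [integral_complex_ofReal, integral_complex_ofReal] at hdiv
      exact_mod_cast hdiv
    have hint : Integrable (fun y => inner ℝ (outerNormal D y) (e i) * (ρ i y * ‖f y‖ ^ 2))
        (arcLength D) := by
      have := (hD.integrable_inner_normal_mul (e i) hgC.continuous).re
      simpa [← Complex.ofReal_mul, -Complex.ofReal_pow] using this
    have hlow : c i * ∫ y, ρ i y * ‖f y‖ ^ 2 ∂(arcLength D)
        ≤ ∫ y, inner ℝ (outerNormal D y) (e i) * (ρ i y * ‖f y‖ ^ 2) ∂(arcLength D) := by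
      rw [← integral_const_mul]
      refine integral_mono_ae (hgi.const_mul _) hint ?_
      have := (ae_restrict_iff' (hU i).isOpen.measurableSet).1 (hU i).transversal
      filter_upwards [this] with y hy
      by_cases hyU : y ∈ U i
      · exact mul_le_mul_of_nonneg_right (hy hyU)
          (mul_nonneg ((hρ i).2.2 y) (by positivity))
      · have : ρ i y = 0 :=
          image_eq_zero_of_notMem_tsupport fun hy' => hyU ((hρ i).2.1 hy')
        simp [this]
    have hup : ∫ y in D, fderiv ℝ (fun y => ρ i y * ‖f y‖ ^ 2) y (e i)
        ≤ (|B i| + |A i| * (1 + 2 * ‖e i‖ ^ 2)) * ∫ y in D, E y := by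
      rw [← integral_const_mul]
      exact setIntegral_mono_on
        (hD.integrableOn_of_continuous (continuous_fderiv_apply (hg i) (e i)))
        ((hD.integrableOn_of_continuous hEc).const_mul _) hD.isOpen.measurableSet (hbound i)
    rw [hK]
    simp only
    rw [mul_assoc, inv_mul_eq_div, le_div_iff₀ hc, mul_comm]
    linarith
  calc ∫ y, ‖f y‖ ^ 2 ∂(arcLength D)
      = ∫ y, ∑ i, ρ i y * ‖f y‖ ^ 2 ∂(arcLength D) := by
        refine integral_congr_ae ?_
        filter_upwards [ae_mem_frontier D] with y hy
        rw [← Finset.sum_mul, hsum y (frontier_subset_closure hy), one_mul]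
    _ = ∑ i, ∫ y, ρ i y * ‖f y‖ ^ 2 ∂(arcLength D) :=
        integral_finsetSum _ fun i _ =>
          memLp_one_iff_integrable.1 (hD.memLp_arcLength_of_continuous (hg i).continuous 1)
    _ ≤ ∑ i, K i * ∫ y in D, E y := Finset.sum_le_sum fun i _ => hpatch i
    _ = _ := by rw [Finset.sum_mul]

end IsLipschitzDomain

/-! ### Smooth approximation by mollification -/

/-- The translates of an `L²` function converge to it in `L²`. -/
theorem tendsto_eLpNorm_translate_sub {g : Plane → ℂ} (hg : MemLp g 2 volume) :
    Tendsto (fun t : Plane => eLpNorm (fun x => g (x - t) - g x) 2 volume) (𝓝 0) (𝓝 0) := by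
  set T : C(Plane, C(Plane, Plane)) :=
    (ContinuousMap.mk (fun p : Plane × Plane => p.2 - p.1) (by fun_prop)).curry with hT
  have hTm : ∀ t, MeasurePreserving (T t) volume volume := fun t =>
    measurePreserving_sub_right volume t
  have h := Tendsto.compMeasurePreservingLp (E := ℂ) (p := 2)
    (tendsto_const_nhds (x := hg.toLp g)) (T.continuous.tendsto 0) hTm (hTm 0)
    ENNReal.ofNat_ne_top
  simp only [Lp.toLp_compMeasurePreserving] at h
  rw [Lp.tendsto_Lp_iff_tendsto_eLpNorm''] at h
  refine h.congr fun t => ?_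
  congr 1
  funext x
  simp [hT]

/-- The convolution of `g` with the kernel `ρ`. -/
noncomputable def mollify (ρ : Plane → ℝ) (g : Plane → ℂ) : Plane → ℂ :=
  convolution ρ g (ContinuousLinearMap.lsmul ℝ ℝ) volume

theorem mollify_apply (ρ : Plane → ℝ) (g : Plane → ℂ) (x : Plane) :
    mollify ρ g x = ∫ t, ρ t • g (x - t) := rfl

/-- Convolution with a probability density moves `g` by at most the largest `L²` distance of `g`
to its translates by vectors in the support of the density (Jensen's inequality). -/
theorem eLpNorm_mollify_sub_le {ρ : Plane → ℝ} (hρc : Continuous ρ) (hρs : HasCompactSupport ρ)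
    (hρ0 : ∀ t, 0 ≤ ρ t) (hρ1 : ∫ t, ρ t = 1) {g : Plane → ℂ} (hgm : Measurable g)
    (hg : MemLp g 2 volume) {ε : ℝ≥0∞}
    (hε : ∀ t ∈ Function.support ρ, eLpNorm (fun x => g (x - t) - g x) 2 volume ≤ ε) :
    eLpNorm (fun x => mollify ρ g x - g x) 2 volume ≤ ε := by
  have hint : Integrable ρ := hρc.integrable_of_hasCompactSupport hρs
  have hw : Measurable fun t => ENNReal.ofReal (ρ t) := hρc.measurable.ennreal_ofReal
  set ν : Measure Plane := volume.withDensity fun t => ENNReal.ofReal (ρ t) with hν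
  have hνp : IsProbabilityMeasure ν := by
    refine ⟨?_⟩
    rw [hν, withDensity_apply _ MeasurableSet.univ, Measure.restrict_univ,
      ← ofReal_integral_eq_lintegral_ofReal hint (Eventually.of_forall hρ0), hρ1,
      ENNReal.ofReal_one]
  have hex := hρs.convolutionExists_left (ContinuousLinearMap.lsmul ℝ ℝ) hρc
    (hg.locallyIntegrable one_le_two)
  have hpt : ∀ x, ‖mollify ρ g x - g x‖ₑ ^ 2 ≤ ∫⁻ t, ‖g (x - t) - g x‖ₑ ^ 2 ∂ν := by
    intro x
    have hm : Measurable fun t => g (x - t) - g x :=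
      (hgm.comp (measurable_const.sub measurable_id)).sub_const _
    have h1 : mollify ρ g x - g x = ∫ t, ρ t • (g (x - t) - g x) := by
      have h2 : g x = ∫ t, ρ t • g x := by rw [integral_smul_const, hρ1, one_smul]
      conv_lhs => rw [h2]
      have hex' : Integrable fun t => ρ t • g (x - t) := hex x
      rw [mollify_apply, ← integral_sub hex' (hint.smul_const _)]
      simp only [smul_sub]
    have h3 : ‖mollify ρ g x - g x‖ₑ ≤ ∫⁻ t, ‖g (x - t) - g x‖ₑ ∂ν := by
      rw [h1, hν, lintegral_withDensity_eq_lintegral_mul _ hw hm.enorm]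
      refine (enorm_integral_le_lintegral_enorm _).trans_eq (lintegral_congr fun t => ?_)
      rw [enorm_smul, Pi.mul_apply, Real.enorm_eq_ofReal (hρ0 t)]
    have h4 := eLpNorm_le_eLpNorm_of_exponent_le (μ := ν) (p := 1) (q := 2) one_le_two
      hm.aestronglyMeasurable
    rw [eLpNorm_one_eq_lintegral_enorm] at h4
    have h5 := eLpNorm_nnreal_pow_eq_lintegral (μ := ν) (f := fun t => g (x - t) - g x)
      (p := 2) two_ne_zero
    simp only [NNReal.coe_ofNat, ENNReal.rpow_ofNat, ENNReal.coe_ofNat] at h5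
    rw [← h5]
    gcongr
    exact h3.trans h4
  have hsq : ∀ (f : Plane → ℂ), eLpNorm f 2 volume ^ 2 = ∫⁻ x, ‖f x‖ₑ ^ 2 := fun f => by
    have h5 := eLpNorm_nnreal_pow_eq_lintegral (μ := volume) (f := f) (p := 2) two_ne_zero
    simpa using h5
  rw [← ENNReal.pow_le_pow_left_iff two_ne_zero, hsq]
  calc ∫⁻ x, ‖mollify ρ g x - g x‖ₑ ^ 2
      ≤ ∫⁻ x, ∫⁻ t, ‖g (x - t) - g x‖ₑ ^ 2 ∂ν := lintegral_mono hpt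
    _ = ∫⁻ t, (∫⁻ x, ‖g (x - t) - g x‖ₑ ^ 2) ∂ν := by
        refine lintegral_lintegral_swap (Measurable.aemeasurable ?_)
        exact (((hgm.comp (measurable_fst.sub measurable_snd)).sub
          (hgm.comp measurable_fst)).enorm.pow_const 2)
    _ ≤ ∫⁻ _, ε ^ 2 ∂ν := by
        refine lintegral_mono_ae ?_
        rw [hν, ae_withDensity_iff hw]
        refine Eventually.of_forall fun t ht => ?_
        rw [← hsq]
        gcongr
        refine hε t fun h0 => ht ?_
        rw [h0, ENNReal.ofReal_zero]
    _ = ε ^ 2 := by simp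

/-- The function `g` on `Ω`, extended by zero to the plane. -/
noncomputable def extendZero {Ω : Set Plane} (g : L2 Ω) : Plane → ℂ := Ω.indicator g

theorem measurable_extendZero {Ω : Set Plane} (hΩ : IsOpen Ω) (g : L2 Ω) :
    Measurable (extendZero g) :=
  (Lp.stronglyMeasurable g).measurable.indicator hΩ.measurableSet

theorem memLp_extendZero {Ω : Set Plane} (hΩ : IsOpen Ω) (g : L2 Ω) :
    MemLp (extendZero g) 2 volume :=
  (memLp_indicator_iff_restrict hΩ.measurableSet).2 (Lp.memLp g)

theorem integral_smul_extendZero {Ω : Set Plane} (hΩ : IsOpen Ω) (g : L2 Ω) (w : Plane → ℝ) :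
    ∫ y, w y • extendZero g y = ∫ y in Ω, g y * (w y : ℂ) := by
  rw [← integral_indicator hΩ.measurableSet]
  congr 1
  funext y
  by_cases hy : y ∈ Ω <;> simp [extendZero, hy, mul_comm]

/-- Away from the boundary of `Ω`, mollification commutes with weak differentiation. -/
theorem partialDeriv_mollify {Ω : Set Plane} (hΩ : IsOpen Ω) {ρ : Plane → ℝ} {δ : ℝ}
    (hρ : ContDiff ℝ ∞ ρ) (hρs : tsupport ρ ⊆ Metric.closedBall 0 δ) {i : Fin 2} {f g : L2 Ω}
    (hfg : HasWeakPartialDeriv Ω i f g) {x : Plane} (hx : Metric.closedBall x δ ⊆ Ω) :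
    partialDeriv i (mollify ρ (extendZero f)) x = mollify ρ (extendZero g) x := by
  have hc : HasCompactSupport ρ :=
    (isCompact_closedBall 0 δ).of_isClosed_subset (isClosed_tsupport ρ) hρs
  have hρ1 : ContDiff ℝ 1 ρ := hρ.of_le (by exact_mod_cast le_top)
  have hloc : LocallyIntegrable (extendZero f) volume :=
    (memLp_extendZero hΩ f).locallyIntegrable one_le_two
  have hder := (hc.hasFDerivAt_convolution_left (ContinuousLinearMap.lsmul ℝ ℝ) hρ1 hloc x).fderiv
  have hex := (hc.fderiv (𝕜 := ℝ)).convolutionExists_left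
    ((ContinuousLinearMap.lsmul ℝ ℝ : ℝ →L[ℝ] ℂ →L[ℝ] ℂ).precompL Plane)
    (hρ1.continuous_fderiv one_ne_zero) hloc x
  have h1 : partialDeriv i (mollify ρ (extendZero f)) x
      = ∫ t, fderiv ℝ ρ t (EuclideanSpace.single i 1) • extendZero f (x - t) := by
    rw [partialDeriv, mollify, hder, convolution_def, ContinuousLinearMap.integral_apply hex]
    rfl
  set ψ : Plane → ℂ := fun y => (ρ (x - y) : ℂ) with hψ
  have hsub : ContDiff ℝ ∞ fun y : Plane => x - y := by fun_prop
  have hψs : tsupport ψ ⊆ Metric.closedBall x δ := by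
    refine closure_minimal (fun y hy => ?_) Metric.isClosed_closedBall
    have : ρ (x - y) ≠ 0 := Complex.ofReal_ne_zero.1 hy
    have := hρs (subset_tsupport _ this)
    rwa [mem_closedBall_zero_iff, ← dist_eq_norm, dist_comm] at this
  have hψt : IsTestFunction Ω ψ :=
    ⟨Complex.ofRealCLM.contDiff.comp (hρ.comp hsub),
      (isCompact_closedBall x δ).of_isClosed_subset (isClosed_tsupport ψ) hψs, hψs.trans hx⟩
  have hψd : ∀ y, partialDeriv i ψ y
      = ((-fderiv ℝ ρ (x - y) (EuclideanSpace.single i 1) : ℝ) : ℂ) := by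
    intro y
    have hd : HasFDerivAt (fun y : Plane => x - y) (-ContinuousLinearMap.id ℝ Plane) y :=
      (hasFDerivAt_id y).const_sub x
    have := (Complex.ofRealCLM.hasFDerivAt.comp y
      (((hρ1.differentiable one_ne_zero (x - y)).hasFDerivAt).comp y hd)).fderiv
    rw [partialDeriv]
    refine (congrArg (fun T => T (EuclideanSpace.single i 1)) this).trans ?_
    simp
  have hweak := hfg ψ hψt
  rw [h1, mollify_apply, ← integral_sub_left_eq_self _ volume x,
    ← integral_sub_left_eq_self (fun t => ρ t • extendZero g (x - t)) volume x]
  simp only [sub_sub_cancel]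
  rw [integral_smul_extendZero hΩ f fun y => fderiv ℝ ρ (x - y) (EuclideanSpace.single i 1),
    integral_smul_extendZero hΩ g fun y => ρ (x - y)]
  simp only [hψd, Complex.ofReal_neg, mul_neg, integral_neg] at hweak
  exact neg_injective hweak

/-- Interior approximation: near the compact set `closure D ⊆ Ω`, a function in `H¹(Ω)` is the
`H¹` limit of smooth functions on the plane. -/
theorem exists_smooth_approx {Ω D : Set Plane} (hΩ : IsOpen Ω) (hDo : IsOpen D)
    (hD : IsCompact (closure D)) (hDΩ : closure D ⊆ Ω) (u : H1 Ω) :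
    ∃ φ : ℕ → Plane → ℂ, (∀ n, ContDiff ℝ ∞ (φ n)) ∧
      Tendsto (fun n => eLpNorm (fun x => φ n x - val u x) 2 (volume.restrict D)) atTop (𝓝 0) ∧
      ∀ i, Tendsto (fun n => eLpNorm (fun x => partialDeriv i (φ n) x - grad u i x) 2
        (volume.restrict D)) atTop (𝓝 0) := by
  obtain ⟨δ₀, hδ₀, hthick⟩ := hD.exists_cthickening_subset_open hΩ hDΩ
  set δ : ℕ → ℝ := fun n => δ₀ / (n + 1) with hδ
  have hδpos : ∀ n, 0 < δ n := fun n => by positivity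
  have hδle : ∀ n, δ n ≤ δ₀ := fun n => div_le_self hδ₀.le (by simp)
  have hδlim : Tendsto δ atTop (𝓝 0) := by
    have := (tendsto_one_div_add_atTop_nhds_zero_nat (𝕜 := ℝ)).const_mul δ₀
    simpa [hδ, div_eq_mul_inv] using this
  set b : ∀ n, ContDiffBump (0 : Plane) := fun n =>
    ⟨δ n / 2, δ n, half_pos (hδpos n), half_lt_self (hδpos n)⟩ with hb
  set ρ : ℕ → Plane → ℝ := fun n => (b n).normed volume with hρ
  have hsm : ∀ n, ContDiff ℝ ∞ (ρ n) := fun n => (b n).contDiff_normed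
  have hts : ∀ n, tsupport (ρ n) ⊆ Metric.closedBall 0 (δ n) := fun n =>
    ((b n).tsupport_normed_eq (μ := volume)).subset
  have hcs : ∀ n, HasCompactSupport (ρ n) := fun n => (b n).hasCompactSupport_normed
  -- mollification converges in `L²` of the whole plane
  have hconv : ∀ g : L2 Ω, Tendsto (fun n => eLpNorm
      (fun x => mollify (ρ n) (extendZero g) x - extendZero g x) 2 volume) atTop (𝓝 0) := by
    intro g
    rw [ENNReal.tendsto_nhds_zero]
    intro ε hε
    obtain ⟨η, hη, hηε⟩ := Metric.eventually_nhds_iff.1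
      (ENNReal.tendsto_nhds_zero.1 (tendsto_eLpNorm_translate_sub (memLp_extendZero hΩ g)) ε hε)
    filter_upwards [hδlim.eventually (gt_mem_nhds hη)] with n hn
    refine eLpNorm_mollify_sub_le (hsm n).continuous (hcs n) (fun t => (b n).nonneg_normed t)
      (b n).integral_normed (measurable_extendZero hΩ g) (memLp_extendZero hΩ g) fun t ht => ?_
    refine hηε ?_
    have : t ∈ Metric.closedBall (0 : Plane) (δ n) := hts n (subset_tsupport _ ht)
    exact (Metric.mem_closedBall.1 this).trans_lt hn
  have hrestr : ∀ (g : L2 Ω) (F : ℕ → Plane → ℂ),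
      (∀ n, ∀ x ∈ D, F n x = mollify (ρ n) (extendZero g) x) →
      Tendsto (fun n => eLpNorm (fun x => F n x - g x) 2 (volume.restrict D)) atTop (𝓝 0) := by
    intro g F hF
    refine tendsto_of_tendsto_of_tendsto_of_le_of_le tendsto_const_nhds (hconv g)
      (fun _ => zero_le) fun n => ?_
    refine le_trans (le_of_eq ?_) (eLpNorm_mono_measure _ (Measure.restrict_le_self (s := D)))
    refine eLpNorm_congr_ae ?_
    filter_upwards [ae_restrict_mem hDo.measurableSet] with x hx
    rw [hF n x hx, extendZero, indicator_of_mem (hDΩ (subset_closure hx))]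
  refine ⟨fun n => mollify (ρ n) (extendZero (val u)), fun n => ?_, ?_, fun i => ?_⟩
  · exact (hcs n).contDiff_convolution_left _ (hsm n)
      ((memLp_extendZero hΩ (val u)).locallyIntegrable one_le_two)
  · exact hrestr (val u) _ fun n x _ => rfl
  · refine hrestr (grad u i) _ fun n x hx => ?_
    refine partialDeriv_mollify hΩ (hsm n) (hts n) (u.2 i) ?_
    exact (Metric.closedBall_subset_closedBall (hδle n)).trans
      ((Metric.closedBall_subset_cthickening (subset_closure hx) δ₀).trans hthick)

/-! ### Existence of the trace -/

theorem eLpNorm_two_eq_ofReal_sqrt {μ : Measure Plane} {f : Plane → ℂ} (hf : MemLp f 2 μ) :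
    eLpNorm f 2 μ = ENNReal.ofReal (√(∫ y, ‖f y‖ ^ 2 ∂μ)) := by
  rw [hf.eLpNorm_eq_integral_rpow_norm two_ne_zero ENNReal.ofNat_ne_top, Real.sqrt_eq_rpow]
  simp

theorem IsLipschitzDomain.memLp_restrict_of_continuous {D : Set Plane} (hD : IsLipschitzDomain D)
    {f : Plane → ℂ} (hf : Continuous f) : MemLp f 2 (volume.restrict D) := by
  have : IsFiniteMeasure (volume.restrict D) := ⟨by
    rw [Measure.restrict_apply_univ]
    exact (measure_mono subset_closure).trans_lt hD.isCompact_closure.measure_lt_top⟩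
  obtain ⟨M, hM⟩ := hD.isCompact_closure.exists_bound_of_continuousOn hf.continuousOn
  exact MemLp.of_bound hf.aestronglyMeasurable M
    ((ae_restrict_mem hD.isOpen.measurableSet).mono fun y hy => hM y (subset_closure hy))

theorem continuous_partialDeriv {f : Plane → ℂ} (hf : ContDiff ℝ 1 f) (i : Fin 2) :
    Continuous (partialDeriv i f) :=
  (hf.continuous_fderiv one_ne_zero).clm_apply continuous_const

theorem IsLipschitzDomain.exists_eLpNorm_trace_bound {D : Set Plane} (hD : IsLipschitzDomain D) :
    ∃ C : ℝ, ∀ f : Plane → ℂ, ContDiff ℝ 1 f → eLpNorm f 2 (arcLength D) ≤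
      ENNReal.ofReal C * (eLpNorm f 2 (volume.restrict D)
        + ∑ i, eLpNorm (partialDeriv i f) 2 (volume.restrict D)) := by
  obtain ⟨C, hC0, hC⟩ := hD.exists_trace_bound
  refine ⟨√C, fun f hf => ?_⟩
  have hE := hC f hf
  rw [eLpNorm_two_eq_ofReal_sqrt (hD.memLp_arcLength_of_continuous hf.continuous 2),
    eLpNorm_two_eq_ofReal_sqrt (hD.memLp_restrict_of_continuous hf.continuous)]
  simp only [fun i => eLpNorm_two_eq_ofReal_sqrt
    (hD.memLp_restrict_of_continuous (continuous_partialDeriv hf i)), Fin.sum_univ_two] at hE ⊢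
  rw [← ENNReal.ofReal_add (by positivity) (by positivity),
    ← ENNReal.ofReal_add (by positivity) (by positivity), ← ENNReal.ofReal_mul (by positivity)]
  refine ENNReal.ofReal_le_ofReal ((Real.sqrt_le_sqrt hE).trans ?_)
  have hnn : ∀ g : Plane → ℂ, 0 ≤ ∫ y in D, ‖g y‖ ^ 2 := fun g =>
    integral_nonneg fun y => by positivity
  rw [Real.sqrt_mul hC0]
  gcongr
  refine Real.sqrt_le_iff.2 ⟨by positivity, ?_⟩
  have e0 := Real.sq_sqrt (hnn f)
  have e1 := Real.sq_sqrt (hnn (partialDeriv 0 f))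
  have e2 := Real.sq_sqrt (hnn (partialDeriv 1 f))
  set a := √(∫ y in D, ‖f y‖ ^ 2)
  set b := √(∫ y in D, ‖partialDeriv 0 f y‖ ^ 2)
  set c := √(∫ y in D, ‖partialDeriv 1 f y‖ ^ 2)
  have ha : 0 ≤ a := Real.sqrt_nonneg _
  have hb : 0 ≤ b := Real.sqrt_nonneg _
  have hc : 0 ≤ c := Real.sqrt_nonneg _
  rw [← e0, ← e1, ← e2]
  nlinarith [mul_nonneg ha hb, mul_nonneg ha hc, mul_nonneg hb hc]

theorem partialDeriv_sub {f g : Plane → ℂ} (hf : ContDiff ℝ 1 f) (hg : ContDiff ℝ 1 g)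
    (i : Fin 2) (x : Plane) :
    partialDeriv i (fun y => f y - g y) x = partialDeriv i f x - partialDeriv i g x := by
  rw [partialDeriv, fderiv_fun_sub (hf.differentiable one_ne_zero x)
    (hg.differentiable one_ne_zero x)]
  rfl

theorem eLpNorm_sub_le_add {μ : Measure Plane} {f g h : Plane → ℂ}
    (hf : AEStronglyMeasurable f μ) (hg : AEStronglyMeasurable g μ)
    (hh : AEStronglyMeasurable h μ) :
    eLpNorm (fun x => f x - g x) 2 μ
      ≤ eLpNorm (fun x => f x - h x) 2 μ + eLpNorm (fun x => g x - h x) 2 μ := by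
  have : (fun x => f x - g x) = (fun x => f x - h x) - fun x => g x - h x := by
    funext x
    simp
  rw [this]
  exact eLpNorm_sub_le (hf.sub hh) (hg.sub hh) one_le_two

/-- A function in `H¹(Ω)` has a trace on the boundary of a Lipschitz domain compactly contained
in `Ω`: by the trace inequality, the boundary values of smooth approximations form a Cauchy
sequence in `L²(∂D)`. -/
theorem exists_isTrace {Ω D : Set Plane} (hΩ : IsOpen Ω) (hD : IsLipschitzDomain D)
    (hDΩ : closure D ⊆ Ω) (u : H1 Ω) : ∃ g, IsTrace D u g := by
  obtain ⟨φ, hφ, h0, h1⟩ := exists_smooth_approx hΩ hD.isOpen hD.isCompact_closure hDΩ u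
  obtain ⟨C, hC⟩ := hD.exists_eLpNorm_trace_bound
  have hφ1 : ∀ n, ContDiff ℝ 1 (φ n) := fun n => (hφ n).of_le (by exact_mod_cast le_top)
  have hle : volume.restrict D ≤ volume.restrict Ω :=
    Measure.restrict_mono (subset_closure.trans hDΩ) le_rfl
  have hmeas : ∀ g : L2 Ω, AEStronglyMeasurable g (volume.restrict D) := fun g =>
    (Lp.aestronglyMeasurable g).mono_measure hle
  set a : ℕ → ℝ≥0∞ := fun n => eLpNorm (fun x => φ n x - val u x) 2 (volume.restrict D)
    + ∑ i, eLpNorm (fun x => partialDeriv i (φ n) x - grad u i x) 2 (volume.restrict D) with ha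
  have halim : Tendsto (fun n => ENNReal.ofReal C * a n) atTop (𝓝 0) := by
    have h2 : Tendsto a atTop (𝓝 0) := by
      simpa [ha] using h0.add (tendsto_finsetSum Finset.univ fun i _ => h1 i)
    simpa using ENNReal.Tendsto.const_mul h2 (Or.inr ENNReal.ofReal_ne_top)
  have hdiff : ∀ n m, eLpNorm (fun x => φ n x - φ m x) 2 (arcLength D)
      ≤ ENNReal.ofReal C * a n + ENNReal.ofReal C * a m := by
    intro n m
    refine (hC _ ((hφ1 n).sub (hφ1 m))).trans ?_
    rw [← mul_add]
    refine mul_le_mul_right ?_ _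
    have e1 := eLpNorm_sub_le_add (hφ n).continuous.aestronglyMeasurable
      (hφ m).continuous.aestronglyMeasurable (hmeas (val u))
    have e2 : ∀ i, eLpNorm (partialDeriv i fun x => φ n x - φ m x) 2 (volume.restrict D)
        ≤ eLpNorm (fun x => partialDeriv i (φ n) x - grad u i x) 2 (volume.restrict D)
        + eLpNorm (fun x => partialDeriv i (φ m) x - grad u i x) 2 (volume.restrict D) := by
      intro i
      have : (partialDeriv i fun x => φ n x - φ m x)
          = fun x => partialDeriv i (φ n) x - partialDeriv i (φ m) x :=
        funext fun x => partialDeriv_sub (hφ1 n) (hφ1 m) i x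
      rw [this]
      exact eLpNorm_sub_le_add (continuous_partialDeriv (hφ1 n) i).aestronglyMeasurable
        (continuous_partialDeriv (hφ1 m) i).aestronglyMeasurable (hmeas (grad u i))
    refine (add_le_add e1 (Finset.sum_le_sum fun i _ => e2 i)).trans_eq ?_
    rw [Finset.sum_add_distrib, ha]
    simp only
    abel
  have hmem : ∀ n, MemLp (φ n) 2 (arcLength D) := fun n =>
    hD.memLp_arcLength_of_continuous (hφ n).continuous 2
  have hcau : CauchySeq fun n => (hmem n).toLp (φ n) := by
    refine EMetric.cauchySeq_iff.2 fun ε hε => ?_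
    obtain ⟨N, hN⟩ := eventually_atTop.1
      (halim.eventually (gt_mem_nhds (ENNReal.half_pos hε.ne')))
    refine ⟨N, fun m hm n hn => ?_⟩
    rw [Lp.edist_toLp_toLp]
    calc _ ≤ _ := hdiff m n
      _ < ε / 2 + ε / 2 := ENNReal.add_lt_add (hN m hm) (hN n hn)
      _ = ε := ENNReal.add_halves ε
  obtain ⟨g, hg⟩ := cauchySeq_tendsto_of_complete hcau
  refine ⟨g, Lp.memLp g, φ, hφ, h0, h1, ?_⟩
  have hg' : Tendsto (fun n => (hmem n).toLp (φ n)) atTop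
      (𝓝 ((Lp.memLp g).toLp g)) := by rwa [Lp.toLp_coeFn]
  exact (Lp.tendsto_Lp_iff_tendsto_eLpNorm'' _ _ _ _).1 hg'

/-! ### Harmonic functions and their weak gradients -/

theorem partialDeriv_partialDeriv {V : Plane → ℂ} {x : Plane} (hV : ContDiffAt ℝ 2 V x)
    (i : Fin 2) : partialDeriv i (partialDeriv i V) x
      = fderiv ℝ (fderiv ℝ V) x (EuclideanSpace.single i 1) (EuclideanSpace.single i 1) := by
  have hd : HasFDerivAt (fderiv ℝ V) (fderiv ℝ (fderiv ℝ V) x) x :=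
    ((hV.fderiv_right (m := 1) (by norm_num)).differentiableAt one_ne_zero).hasFDerivAt
  have := (hd.clm_apply (hasFDerivAt_const (EuclideanSpace.single i (1 : ℝ)) x)).fderiv
  refine (congrArg (fun T => T (EuclideanSpace.single i 1)) this).trans ?_
  simp

theorem sum_partialDeriv_partialDeriv {V : Plane → ℂ} {x : Plane}
    (hV : InnerProductSpace.HarmonicAt V x) : ∑ i, partialDeriv i (partialDeriv i V) x = 0 := by
  have h := hV.2.self_of_nhds
  rw [InnerProductSpace.laplacian_eq_iteratedFDeriv_orthonormalBasis V
    (EuclideanSpace.basisFun (Fin 2) ℝ)] at h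
  simp only [iteratedFDeriv_two_apply, EuclideanSpace.basisFun_apply] at h
  simp only [partialDeriv_partialDeriv hV.1]
  exact h

theorem contDiffOn_partialDeriv {Ω : Set Plane} (hΩ : IsOpen Ω) {V : Plane → ℂ}
    (hV : ContDiffOn ℝ 2 V Ω) (i : Fin 2) : ContDiffOn ℝ 1 (partialDeriv i V) Ω :=
  (hV.fderiv_of_isOpen hΩ (by norm_num)).clm_apply contDiffOn_const

theorem integrable_mul_of_tsupport_subset {Ω : Set Plane} (hΩ : IsOpen Ω) {f φ : Plane → ℂ}
    (hf : ContinuousOn f Ω) (hφ : Continuous φ) (hc : HasCompactSupport φ)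
    (hs : tsupport φ ⊆ Ω) : Integrable (fun x => f x * φ x) := by
  have h1 : tsupport (fun x => f x * φ x) ⊆ tsupport φ :=
    closure_mono (Function.support_mul_subset_right f φ)
  have h2 : Continuous fun x => f x * φ x :=
    (hf.mul hφ.continuousOn).continuous_of_tsupport_subset hΩ (h1.trans hs)
  exact h2.integrable_of_hasCompactSupport (hc.mono' (subset_tsupport _ |>.trans h1))

/-- Integration by parts against a test function. -/
theorem integral_mul_partialDeriv_testFunction {Ω : Set Plane} (hΩ : IsOpen Ω) {f φ : Plane → ℂ}
    (hf : ContDiffOn ℝ 1 f Ω) (hφ : IsTestFunction Ω φ) (i : Fin 2) :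
    ∫ x in Ω, f x * partialDeriv i φ x = -∫ x in Ω, partialDeriv i f x * φ x := by
  have hφ1 : ContDiff ℝ 1 φ := hφ.contDiff.of_le (by exact_mod_cast le_top)
  have hz : ∀ x, x ∉ Ω → φ x = 0 := fun x hx =>
    image_eq_zero_of_notMem_tsupport fun hx' => hx (hφ.tsupport_subset hx')
  have hdz : ∀ x, x ∉ Ω → partialDeriv i φ x = 0 := fun x hx => by
    rw [partialDeriv, image_eq_zero_of_notMem_tsupport fun hx' =>
      hx (hφ.tsupport_subset (tsupport_fderiv_subset ℝ hx'))]
    rfl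
  have hds : tsupport (partialDeriv i φ) ⊆ Ω :=
    (tsupport_fderiv_apply_subset ℝ _).trans hφ.tsupport_subset
  have hdc : HasCompactSupport (partialDeriv i φ) := hφ.hasCompactSupport.fderiv_apply ℝ _
  rw [setIntegral_eq_integral_of_forall_compl_eq_zero fun x hx => by rw [hdz x hx, mul_zero],
    setIntegral_eq_integral_of_forall_compl_eq_zero fun x hx => by rw [hz x hx, mul_zero]]
  have hdf : ContinuousOn (partialDeriv i f) Ω :=
    (hf.continuousOn_fderiv_of_isOpen hΩ le_rfl).clm_apply continuousOn_const
  -- the product rule only concerns the compact support of `φ`, where `f` is smooth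
  refine integral_mul_fderiv_eq_neg_fderiv_mul_of_integrable
    (integrable_mul_of_tsupport_subset hΩ hdf hφ1.continuous hφ.hasCompactSupport
      hφ.tsupport_subset)
    (integrable_mul_of_tsupport_subset hΩ hf.continuousOn (continuous_partialDeriv hφ1 i) hdc hds)
    (integrable_mul_of_tsupport_subset hΩ hf.continuousOn hφ1.continuous hφ.hasCompactSupport
      hφ.tsupport_subset)
    (fun x hx => (hf.differentiableOn one_ne_zero).differentiableAt
      (hΩ.mem_nhds (hφ.tsupport_subset hx)))
    fun x _ => hφ1.differentiable one_ne_zero x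

/-- The weak gradient of a `C¹` function is its classical gradient. -/
theorem grad_ae_eq_partialDeriv {Ω : Set Plane} (hΩ : IsOpen Ω) {v : H1 Ω} {V : Plane → ℂ}
    (hV : ContDiffOn ℝ 1 V Ω) (hvV : val v =ᵐ[volume.restrict Ω] V) (i : Fin 2) :
    grad v i =ᵐ[volume.restrict Ω] partialDeriv i V := by
  have hdf : ContinuousOn (partialDeriv i V) Ω :=
    (hV.continuousOn_fderiv_of_isOpen hΩ le_rfl).clm_apply continuousOn_const
  have hloc : LocallyIntegrableOn (fun x => grad v i x - partialDeriv i V x) Ω volume :=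
    (locallyIntegrableOn_of_locallyIntegrable_restrict
      ((Lp.memLp (grad v i)).locallyIntegrable one_le_two)).sub
      (hdf.locallyIntegrableOn hΩ.measurableSet)
  have key := hΩ.ae_eq_zero_of_integral_contDiff_smul_eq_zero hloc fun χ hχ hχc hχs => ?_
  · rw [EventuallyEq, ae_restrict_iff' hΩ.measurableSet]
    filter_upwards [key] with x hx hxΩ
    exact sub_eq_zero.1 (hx hxΩ)
  · set φ : Plane → ℂ := fun x => (χ x : ℂ) with hφ
    have hs : tsupport φ ⊆ tsupport χ :=
      closure_mono fun x hx => Complex.ofReal_ne_zero.1 hx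
    have hφt : IsTestFunction Ω φ :=
      ⟨Complex.ofRealCLM.contDiff.comp hχ, hχc.of_isClosed_subset (isClosed_tsupport φ) hs,
        hs.trans hχs⟩
    have h1 := v.2 i φ hφt
    have h2 := integral_mul_partialDeriv_testFunction hΩ hV hφt i
    have h3 : ∫ x in Ω, val v x * partialDeriv i φ x = ∫ x in Ω, V x * partialDeriv i φ x := by
      refine integral_congr_ae ?_
      filter_upwards [hvV] with x hx
      rw [hx]
    have h4 : ∫ x in Ω, grad v i x * φ x = ∫ x in Ω, partialDeriv i V x * φ x :=
      neg_injective (h1.symm.trans (h3.trans h2))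
    rw [← setIntegral_eq_integral_of_forall_compl_eq_zero (s := Ω) fun x hx => by
      rw [image_eq_zero_of_notMem_tsupport fun hx' => hx (hχs hx'), zero_smul]]
    have h5 : ∀ x, χ x • (grad v i x - partialDeriv i V x)
        = grad v i x * φ x - partialDeriv i V x * φ x := fun x => by
      rw [Complex.real_smul, hφ]
      ring
    simp only [h5]
    rw [integral_sub (integrable_L2_mul (grad v i) hφt.memLp)
      (integrable_mul_of_tsupport_subset hΩ hdf hφt.contDiff.continuous hφt.hasCompactSupport
        hφt.tsupport_subset).integrableOn, h4, sub_self]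

/-- A harmonic function in `H¹(Ω)` is a weak solution of Laplace's equation. -/
theorem isWeakSolution_one_of_harmonicOnNhd {Ω : Set Plane} (hΩ : IsOpen Ω) {v : H1 Ω}
    {V : Plane → ℂ} (hV : InnerProductSpace.HarmonicOnNhd V Ω)
    (hvV : val v =ᵐ[volume.restrict Ω] V) : IsWeakSolution Coefficient.one v := by
  intro φ hφ
  have hV1 : ContDiffOn ℝ 1 V Ω := hV.contDiffOn.of_le (by norm_num)
  have hd := contDiffOn_partialDeriv hΩ hV.contDiffOn
  have hφ1 : ContDiff ℝ 1 φ := hφ.contDiff.of_le (by exact_mod_cast le_top)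
  have hd2 : ∀ i, ContinuousOn (partialDeriv i (partialDeriv i V)) Ω := fun i =>
    ((hd i).continuousOn_fderiv_of_isOpen hΩ le_rfl).clm_apply continuousOn_const
  calc ∫ x in Ω, (Coefficient.one.toFun x : ℂ) * ∑ i, grad v i x * partialDeriv i φ x
      = ∫ x in Ω, ∑ i, partialDeriv i V x * partialDeriv i φ x := by
        refine integral_congr_ae ?_
        filter_upwards [grad_ae_eq_partialDeriv hΩ hV1 hvV 0,
          grad_ae_eq_partialDeriv hΩ hV1 hvV 1] with x h0 h1
        simp [Coefficient.one, Fin.sum_univ_two, h0, h1]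
    _ = ∑ i, ∫ x in Ω, partialDeriv i V x * partialDeriv i φ x :=
        integral_finsetSum _ fun i _ => (integrable_mul_of_tsupport_subset hΩ
          (hd i).continuousOn (continuous_partialDeriv hφ1 i)
          (hφ.hasCompactSupport.fderiv_apply ℝ _)
          ((tsupport_fderiv_apply_subset ℝ _).trans hφ.tsupport_subset)).integrableOn
    _ = -∑ i, ∫ x in Ω, partialDeriv i (partialDeriv i V) x * φ x := by
        rw [← Finset.sum_neg_distrib]
        exact Finset.sum_congr rfl fun i _ =>
          integral_mul_partialDeriv_testFunction hΩ (hd i) hφ i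
    _ = -∫ x in Ω, ∑ i, partialDeriv i (partialDeriv i V) x * φ x := by
        rw [integral_finsetSum _ fun i _ => (integrable_mul_of_tsupport_subset hΩ
          (hd2 i) hφ1.continuous hφ.hasCompactSupport hφ.tsupport_subset).integrableOn]
    _ = 0 := by
        rw [neg_eq_zero]
        refine (setIntegral_congr_fun (g := fun _ => (0 : ℂ)) hΩ.measurableSet
          fun x hx => ?_).trans (by simp)
        rw [← Finset.sum_mul, sum_partialDeriv_partialDeriv (hV x hx), zero_mul]

/-- A `C²` function near the compact set `K` agrees near `K` with a `C²` function on the plane. -/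
theorem exists_contDiff_eventuallyEq {Ω K : Set Plane} (hΩ : IsOpen Ω) (hK : IsCompact K)
    (hKΩ : K ⊆ Ω) {V : Plane → ℂ} (hV : ContDiffOn ℝ 2 V Ω) :
    ∃ W : Plane → ℂ, ContDiff ℝ 2 W ∧ ∀ x ∈ K, W =ᶠ[𝓝 x] V := by
  obtain ⟨δ, hδ, hthick⟩ := hK.exists_cthickening_subset_open hΩ hKΩ
  obtain ⟨χ, h1, h0, -⟩ := exists_contMDiffMap_one_nhds_of_subset_interior
    (modelWithCornersSelf ℝ Plane) (n := 2) hK.isClosed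
    ((Metric.self_subset_thickening hδ K).trans
      (Metric.thickening_subset_interior_cthickening δ K))
  have hχ : ContDiff ℝ 2 χ :=
    contMDiff_iff_contDiff.1 χ.contMDiff
  refine ⟨fun x => (χ x : ℂ) * V x, contDiff_iff_contDiffAt.2 fun x => ?_, fun x hx => ?_⟩
  · by_cases hx : x ∈ Ω
    · exact (Complex.ofRealCLM.contDiff.comp hχ).contDiffAt.mul (hV.contDiffAt (hΩ.mem_nhds hx))
    · have hxt : (Metric.cthickening δ K)ᶜ ∈ 𝓝 x :=
        Metric.isClosed_cthickening.isOpen_compl.mem_nhds fun hx' => hx (hthick hx')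
      refine (contDiffAt_const (c := (0 : ℂ))).congr_of_eventuallyEq ?_
      filter_upwards [hxt] with y hy
      rw [h0 y hy, Complex.ofReal_zero, zero_mul]
  · filter_upwards [(eventually_nhdsSet_iff_forall.1 h1) x hx] with y hy
    rw [hy, Complex.ofReal_one, one_mul]

/-! ### Green's formula and the boundary identity -/

theorem IsLipschitzDomain.ae_isOuterNormal {D : Set Plane} (hD : IsLipschitzDomain D) :
    ∀ᵐ y ∂(arcLength D), IsOuterNormal D y (outerNormal D y) := by
  obtain ⟨ι, _, U, e, c, ρ, hU, hρ, hsum⟩ := hD.exists_partition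
  have h := ae_all_iff.2 fun i =>
    (ae_restrict_iff' (hU i).isOpen.measurableSet).1 (hU i).transversal
  filter_upwards [h, ae_mem_frontier D] with y hy hyf
  obtain ⟨i, -, hi⟩ := Finset.exists_ne_zero_of_sum_ne_zero
    (by rw [hsum y (frontier_subset_closure hyf)]; exact one_ne_zero)
  have hpos := (hU i).pos.trans_le (hy i ((hρ i).2.1 (subset_tsupport _ hi)))
  -- the value of `outerNormal` is nonzero, hence not the default value
  by_cases hex : ∃ n, IsOuterNormal D y n
  · rw [outerNormal, dif_pos hex]
    exact hex.choose_spec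
  · rw [outerNormal, dif_neg hex, inner_zero_left] at hpos
    exact absurd hpos (lt_irrefl 0)

/-- The derivative of `W` in the direction of the outward normal to `D`. -/
noncomputable def outwardDeriv (D : Set Plane) (W : Plane → ℂ) (y : Plane) : ℂ :=
  fderiv ℝ W y (outerNormal D y)

theorem outwardDeriv_eq_sum (D : Set Plane) (W : Plane → ℂ) (y : Plane) :
    outwardDeriv D W y = ∑ i, ((inner ℝ (outerNormal D y) (EuclideanSpace.single i 1) : ℝ) : ℂ)
      * partialDeriv i W y := by
  rw [outwardDeriv, fderiv_apply_eq_sum_partialDeriv]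
  simp [EuclideanSpace.inner_single_right]

theorem IsLipschitzDomain.memLp_outwardDeriv {D : Set Plane} (hD : IsLipschitzDomain D)
    {W : Plane → ℂ} (hW : ContDiff ℝ 1 W) : MemLp (outwardDeriv D W) 2 (arcLength D) := by
  obtain ⟨M, hM⟩ := hD.isCompact_closure.exists_bound_of_continuousOn
    (hW.continuous_fderiv one_ne_zero).continuousOn
  refine hD.memLp_arcLength (M := M) ?_ (fun y hy => ?_) 2
  · simp only [funext (outwardDeriv_eq_sum D W)]
    exact Finset.aestronglyMeasurable_fun_sum _ fun i _ =>
      (hD.integrable_inner_normal_mul _ (continuous_partialDeriv hW i)).aestronglyMeasurable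
  · refine ((fderiv ℝ W y).le_opNorm _).trans ?_
    refine (mul_le_of_le_one_right (norm_nonneg _) (norm_outerNormal_le D y)).trans ?_
    exact hM y (frontier_subset_closure hy)

theorem partialDeriv_mul {f g : Plane → ℂ} (hf : ContDiff ℝ 1 f) (hg : ContDiff ℝ 1 g)
    (i : Fin 2) (x : Plane) : partialDeriv i (fun y => f y * g y) x
      = partialDeriv i f x * g x + f x * partialDeriv i g x := by
  rw [partialDeriv, fderiv_fun_mul (hf.differentiable one_ne_zero x)
    (hg.differentiable one_ne_zero x)]
  simp only [_root_.add_apply, _root_.smul_apply, smul_eq_mul, partialDeriv]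
  ring

/-- Green's formula in a bounded Lipschitz domain, for `W` harmonic in the domain. -/
theorem IsLipschitzDomain.green {D : Set Plane} (hD : IsLipschitzDomain D) {W : Plane → ℂ}
    (hW : ContDiff ℝ 2 W) (hW0 : ∀ x ∈ D, ∑ i, partialDeriv i (partialDeriv i W) x = 0)
    {f : Plane → ℂ} (hf : ContDiff ℝ 1 f) :
    ∫ x in D, ∑ i, partialDeriv i f x * partialDeriv i W x
      = ∫ y, f y * outwardDeriv D W y ∂(arcLength D) := by
  have hWi : ∀ i, ContDiff ℝ 1 (partialDeriv i W) := fun i =>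
    (hW.fderiv_right (by norm_num)).clm_apply contDiff_const
  have hprod : ∀ i, ContDiff ℝ 1 fun y => f y * partialDeriv i W y := fun i => hf.mul (hWi i)
  calc ∫ x in D, ∑ i, partialDeriv i f x * partialDeriv i W x
      = ∫ x in D, ∑ i, partialDeriv i (fun y => f y * partialDeriv i W y) x := by
        refine setIntegral_congr_fun hD.isOpen.measurableSet fun x hx => ?_
        simp only [partialDeriv_mul hf (hWi _), Finset.sum_add_distrib]
        rw [← Finset.mul_sum, hW0 x hx, mul_zero, add_zero]
    _ = ∑ i, ∫ x in D, partialDeriv i (fun y => f y * partialDeriv i W y) x :=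
        integral_finsetSum _ fun i _ =>
          hD.integrableOn_of_continuous (continuous_partialDeriv (hprod i) i)
    _ = ∑ i, ∫ y, ((inner ℝ (outerNormal D y) (EuclideanSpace.single i 1) : ℝ) : ℂ)
          * (f y * partialDeriv i W y) ∂(arcLength D) :=
        Finset.sum_congr rfl fun i _ => hD.integral_fderiv (hprod i) _
    _ = ∫ y, f y * outwardDeriv D W y ∂(arcLength D) := by
        rw [← integral_finsetSum _ fun i _ =>
          hD.integrable_inner_normal_mul _ (hprod i).continuous]
        congr 1
        funext y
        rw [outwardDeriv_eq_sum, Finset.mul_sum]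
        exact Finset.sum_congr rfl fun i _ => by ring

theorem tendsto_integral_mul_of_eLpNorm {μ : Measure Plane} {F : ℕ → Plane → ℂ} {f b : Plane → ℂ}
    (hF : ∀ n, MemLp (F n) 2 μ) (hf : MemLp f 2 μ) (hb : MemLp b 2 μ)
    (h : Tendsto (fun n => eLpNorm (fun x => F n x - f x) 2 μ) atTop (𝓝 0)) :
    Tendsto (fun n => ∫ x, F n x * b x ∂μ) atTop (𝓝 (∫ x, f x * b x ∂μ)) := by
  refine tendsto_integral_of_L1' _ (hf.integrable_mul hb).aestronglyMeasurable
    (Eventually.of_forall fun n => (hF n).integrable_mul hb) ?_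
  have hlim : Tendsto (fun n => eLpNorm (fun x => F n x - f x) 2 μ * eLpNorm b 2 μ) atTop
      (𝓝 0) := by
    simpa using ENNReal.Tendsto.mul_const h (Or.inr hb.eLpNorm_ne_top)
  refine tendsto_of_tendsto_of_tendsto_of_le_of_le tendsto_const_nhds hlim (fun _ => zero_le)
    fun n => ?_
  have he : ((fun x => F n x * b x) - fun x => f x * b x) = (fun x => F n x - f x) • b := by
    funext x
    simp [sub_mul]
  have hle : eLpNorm ((fun x => F n x - f x) • b) 1 μ
      ≤ eLpNorm (fun x => F n x - f x) 2 μ * eLpNorm b 2 μ :=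
    eLpNorm_smul_le_mul_eLpNorm hb.aestronglyMeasurable ((hF n).sub hf).aestronglyMeasurable
  rwa [← he] at hle

/-- Green's formula for a function in `H¹(Ω)` and its trace on `∂D`. Subtracting the constant `c`
from the smooth approximations does not change their gradients. -/
theorem IsTrace.green {Ω D : Set Plane} (hD : IsLipschitzDomain D) (hDΩ : closure D ⊆ Ω)
    {u : H1 Ω} {g : Plane → ℂ} (hg : IsTrace D u g) {W : Plane → ℂ} (hW : ContDiff ℝ 2 W)
    (hW0 : ∀ x ∈ D, ∑ i, partialDeriv i (partialDeriv i W) x = 0) (c : ℂ) :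
    ∫ x in D, ∑ i, grad u i x * partialDeriv i W x
      = ∫ y, (g y - c) * outwardDeriv D W y ∂(arcLength D) := by
  obtain ⟨hgL, φ, hφ, -, h1, h2⟩ := hg
  have hW1 : ContDiff ℝ 1 W := hW.of_le (by norm_num)
  have hφ1 : ∀ n, ContDiff ℝ 1 fun y => φ n y - c := fun n =>
    ((hφ n).of_le (by exact_mod_cast le_top)).sub contDiff_const
  have hφd : ∀ n i x, partialDeriv i (fun y => φ n y - c) x = partialDeriv i (φ n) x :=
    fun n i x => by rw [partialDeriv, fderiv_sub_const]; rfl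
  have hgrad : ∀ i, MemLp (grad u i) 2 (volume.restrict D) := fun i =>
    (Lp.memLp (grad u i)).mono_measure
      (Measure.restrict_mono (subset_closure.trans hDΩ) le_rfl)
  have hWm : ∀ i, MemLp (partialDeriv i W) 2 (volume.restrict D) := fun i =>
    hD.memLp_restrict_of_continuous (continuous_partialDeriv hW1 i)
  have hφm : ∀ n i, MemLp (partialDeriv i (fun y => φ n y - c)) 2 (volume.restrict D) :=
    fun n i => hD.memLp_restrict_of_continuous (continuous_partialDeriv (hφ1 n) i)
  have hiu : ∀ i, Integrable (fun x => grad u i x * partialDeriv i W x) (volume.restrict D) :=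
    fun i => (hgrad i).integrable_mul (hWm i)
  have hiφ : ∀ n i, Integrable (fun x => partialDeriv i (fun y => φ n y - c) x *
      partialDeriv i W x) (volume.restrict D) := fun n i => (hφm n i).integrable_mul (hWm i)
  have hl : Tendsto (fun n => ∫ x in D, ∑ i,
      partialDeriv i (fun y => φ n y - c) x * partialDeriv i W x) atTop
      (𝓝 (∫ x in D, ∑ i, grad u i x * partialDeriv i W x)) := by
    rw [integral_finsetSum _ fun i _ => hiu i]
    refine (tendsto_finsetSum Finset.univ fun i _ => tendsto_integral_mul_of_eLpNorm
      (fun n => hφm n i) (hgrad i) (hWm i) ?_).congr fun n =>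
        (integral_finsetSum _ fun i _ => hiφ n i).symm
    simpa only [hφd] using h1 i
  have hfin := hD.isFiniteMeasure_arcLength
  have hr : Tendsto (fun n => ∫ y, (φ n y - c) * outwardDeriv D W y ∂(arcLength D)) atTop
      (𝓝 (∫ y, (g y - c) * outwardDeriv D W y ∂(arcLength D))) := by
    refine tendsto_integral_mul_of_eLpNorm
      (fun n => hD.memLp_arcLength_of_continuous (hφ1 n).continuous 2)
      (hgL.sub (memLp_const c)) (hD.memLp_outwardDeriv hW1) ?_
    simpa only [sub_sub_sub_cancel_right] using h2
  exact tendsto_nhds_unique hl (hr.congr fun n => (hD.green hW hW0 (hφ1 n)).symm)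

/-- The difference of the two boundary pairings only sees the contrast of the coefficients. -/
theorem neumann_sub_neumann {Ω D : Set Plane} (hDΩ : D ⊆ Ω) (k : ℝ) (hD : MeasurableSet D)
    {u v : H1 Ω} (hu : IsWeakSolution (inclusion k D hD) u)
    (hv : IsWeakSolution Coefficient.one v) :
    neumann (inclusion k D hD) u hu (boundaryValue v)
        - neumann Coefficient.one v hv (boundaryValue u)
      = (k - 1) * ∫ x in D, ∑ i, grad u i x * grad v i x := by
  have hint : Integrable (fun x => ∑ i, grad u i x * grad v i x) (volume.restrict Ω) :=
    integrable_finsetSum _ fun i _ => (Lp.memLp (grad u i)).integrable_mul (Lp.memLp (grad v i))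
  have hpt : ∀ x, ((inclusion k D hD).toFun x : ℂ) * ∑ i, grad u i x * grad v i x
      = (∑ i, grad u i x * grad v i x)
        + (k - 1) * D.indicator (fun x => ∑ i, grad u i x * grad v i x) x := by
    intro x
    by_cases hx : x ∈ D
    · simp [inclusion, hx]
      ring
    · simp [inclusion, hx]
  have h1 : ∫ x in Ω, (Coefficient.one.toFun x : ℂ) * ∑ i, grad v i x * grad u i x
      = ∫ x in Ω, ∑ i, grad u i x * grad v i x := by
    simp only [Coefficient.one, Complex.ofReal_one, one_mul, mul_comm]
  rw [neumann_boundaryValue, neumann_boundaryValue, h1]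
  simp only [hpt]
  rw [integral_add hint ((hint.indicator hD).const_mul _), integral_const_mul,
    integral_indicator hD, Measure.restrict_restrict hD, inter_eq_self_of_subset_left hDΩ]
  ring

end Conductivity

theorem proposition3p1 (Ω D : Set Conductivity.Plane)
    (hΩ : Conductivity.IsLipschitzDomain Ω) (hD : Conductivity.IsLipschitzDomain D)
    (hDΩ : closure D ⊆ Ω) (k : ℝ) (hk : 0 < k) (hk1 : k ≠ 1)
    (u : Conductivity.H1 Ω)
    (hu : Conductivity.IsWeakSolution
      (Conductivity.inclusion k D hD.isOpen.measurableSet) u)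
    (v : Conductivity.H1 Ω) (hv2 : Conductivity.MemH2 v)
    (V : Conductivity.Plane → ℂ) (hV : InnerProductSpace.HarmonicOnNhd V Ω)
    (hvV : Conductivity.val v =ᵐ[volume.restrict Ω] V) :
    ∃ hv : Conductivity.IsWeakSolution Conductivity.Coefficient.one v,
      (∃ g : Conductivity.Plane → ℂ, Conductivity.IsTrace D u g) ∧
      ∀ g : Conductivity.Plane → ℂ, Conductivity.IsTrace D u g → ∀ c : ℂ,
        Integrable (fun x => (g x - c) * Conductivity.normalDeriv Ω D V x)
          (Conductivity.arcLength D) ∧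
        Conductivity.neumann (Conductivity.inclusion k D hD.isOpen.measurableSet) u hu
            (Conductivity.boundaryValue v)
          - Conductivity.neumann Conductivity.Coefficient.one v hv
            (Conductivity.boundaryValue u)
          = (1 - k) * ∫ x, (g x - c) * Conductivity.normalDeriv Ω D V x
            ∂(Conductivity.arcLength D) := by
  have hv := Conductivity.isWeakSolution_one_of_harmonicOnNhd hΩ.isOpen hV hvV
  refine ⟨hv, Conductivity.exists_isTrace hΩ.isOpen hD hDΩ u, fun g hg c => ?_⟩
  -- replace `V`, which is arbitrary outside `Ω`, by a `C²` function on the plane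
  obtain ⟨W, hW, hWV⟩ := Conductivity.exists_contDiff_eventuallyEq hΩ.isOpen
    hD.isCompact_closure hDΩ hV.contDiffOn
  have hW1 : ContDiff ℝ 1 W := hW.of_le (by norm_num)
  have hpW : ∀ i, ∀ x ∈ closure D,
      Conductivity.partialDeriv i W =ᶠ[𝓝 x] Conductivity.partialDeriv i V := fun i x hx => by
    have hfd : fderiv ℝ W =ᶠ[𝓝 x] fderiv ℝ V := (hWV x hx).fderiv
    filter_upwards [hfd] with y hy
    rw [Conductivity.partialDeriv, hy, Conductivity.partialDeriv]
  have hW0 : ∀ x ∈ D,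
      ∑ i, Conductivity.partialDeriv i (Conductivity.partialDeriv i W) x = 0 := fun x hx => by
    rw [← Conductivity.sum_partialDeriv_partialDeriv (hV x (hDΩ (subset_closure hx)))]
    refine Finset.sum_congr rfl fun i _ => ?_
    have := (hpW i x (subset_closure hx)).fderiv_eq (𝕜 := ℝ)
    exact congrArg (fun T : Conductivity.Plane →L[ℝ] ℂ => T (EuclideanSpace.single i 1)) this
  -- the normal of the statement points into `D`
  have hnormal : ∀ᵐ y ∂(Conductivity.arcLength D), (g y - c) * Conductivity.normalDeriv Ω D V y
      = -((g y - c) * Conductivity.outwardDeriv D W y) := by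
    filter_upwards [hD.ae_isOuterNormal, Conductivity.ae_mem_frontier D]
      with y hy hyf
    have hyc := frontier_subset_closure hyf
    rw [Conductivity.normalDeriv, (hy.sdiff_closure hΩ.isOpen (hDΩ hyc)).outerNormal_eq,
      ← (hWV y hyc).fderiv_eq, map_neg, Conductivity.outwardDeriv, mul_neg]
  have hfin := hD.isFiniteMeasure_arcLength
  have hint : Integrable (fun y => (g y - c) * Conductivity.outwardDeriv D W y)
      (Conductivity.arcLength D) :=
    (hg.1.sub (memLp_const c)).integrable_mul (hD.memLp_outwardDeriv hW1)
  refine ⟨hint.neg.congr (hnormal.mono fun y hy => hy.symm), ?_⟩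
  have hgrad : ∫ x in D, ∑ i, Conductivity.grad u i x * Conductivity.grad v i x
      = ∫ x in D, ∑ i, Conductivity.grad u i x * Conductivity.partialDeriv i W x := by
    refine integral_congr_ae ?_
    have hsub : volume.restrict D ≤ volume.restrict Ω :=
      Measure.restrict_mono (subset_closure.trans hDΩ) le_rfl
    have hV1 : ContDiffOn ℝ 1 V Ω := hV.contDiffOn.of_le (by norm_num)
    have hgr := ae_all_iff.2 fun i =>
      ae_mono hsub (Conductivity.grad_ae_eq_partialDeriv hΩ.isOpen hV1 hvV i)
    filter_upwards [hgr, ae_restrict_mem hD.isOpen.measurableSet] with x hx hxD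
    refine Finset.sum_congr rfl fun i _ => ?_
    rw [hx i, (hpW i x (subset_closure hxD)).self_of_nhds]
  rw [Conductivity.neumann_sub_neumann (subset_closure.trans hDΩ), hgrad,
    hg.green hD hDΩ hW hW0 c, integral_congr_ae hnormal, integral_neg]
  ring
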